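/- Let $K$ be an algebraically closed field, complete with respect to a nontrivial non-Archimedean absolute value $|\cdot|$, and let $p>1$ be a real number (the prime $p$ if $K=\mathbb{C}_p$). An open ball in $\mathbb{P}^1=K\cup\{\infty\}$ is a set $B=\{x\in K:|x-b|<r\}$ or $B=\mathbb{P}^1\setminus\{x\in K:|x-b|\le r\}$ with $b\in K$, $r>0$; the corresponding closed ball is $B^+=\{x\in K:|x-b|\le r\}$, respectively $B^+=\mathbb{P}^1\setminus\{x\in K:|x-b|<r\}$. In both cases let $P_B\in(\mathbb{P}^1)^{an}$ be the point of type 2 or 3 belonging to $\{x\in K:|x-b|\le r\}$. If $P_1,P_2$ are the points belonging to $\{|x-b_1|\le r_1\}$ and $\{|x-b_2|\le r_2\}$, and $R=\max(r_1,r_2,|b_1-b_2|)$ is the radius of the smallest such ball containing both, their distance is $\log_p(R/r_1)+\log_p(R/r_2)$. Let $\Gamma\le PGL(2,K)$ be a Schottky group, i.e. a finitely generated subgroup in which every non-identity element is hyperbolic (is represented by a matrix having two eigenvalues of different absolute value), and let $\gamma_1,\dots,\gamma_g$ be free generators of $\Gamma$. Suppose that they are in good position: there are open balls $B_1,\dots,B_g,B_1',\dots,B_g'$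 such that the $2g$ closed balls $B_i^+,B_i'^+$ are pairwise disjoint and $\gamma_i(\mathbb{P}^1\setminus B_i')=B_i^+$, $\gamma_i^{-1}(\mathbb{P}^1\setminus B_i)=B_i'^+$ for all $i$ (so $F=\mathbb{P}^1\setminus\bigcup_i(B_i\cup B_i')$ is a good fundamental domain). Let $c$ be the smallest pairwise distance between the $2g$ points $P_{B_1},\dots,P_{B_g},P_{B_1'},\dots,P_{B_g'}$. For $m\ge 0$ let $\Gamma_m$ be the set of elements of $\Gamma$ whose reduced word in $\gamma_1^{\pm1},\dots,\gamma_g^{\pm1}$ has length $\le m$, and put $$\Theta_m(a,b;z)=\prod_{\gamma\in\Gamma_m}\frac{z-\gamma a}{z-\gamma b},\qquad \Theta(a,b;z)=\prod_{\gamma\in\Gamma}\frac{z-\gamma a}{z-\gamma b},$$ where for $z\in K$ a difference $z-\infty$ is read as the constant $-1$ (these constants cancel in the quotients below). Let $\Sigma\subset\mathbb{P}^1$ be the set of fixed points of non-identity elements of $\Gamma$ together with their limit points, in the topology generated by the open balls. Let $m\ge1$, let $1\le i,j\le g$, and let $a\in B_i'^+\setminus B_i'$ and $z\in B_j'^+\setminus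 B_j'$ with $a\ne z$. Then the product $$Q=\prod_{\gamma\in\Gamma}\frac{(z-\gamma a)(\gamma_jz-\gamma\gamma_ia)}{(z-\gamma\gamma_ia)(\gamma_jz-\gamma a)}$$ converges unconditionally, $Q\neq0$, and $$\left|\frac{\Theta_m(a,\gamma_ia;z)/\Theta_m(a,\gamma_ia;\gamma_jz)}{Q}-1\right|\le p^{-cm}.$$ If moreover $\infty\notin\Sigma$, then the products $\Theta(a,\gamma_ia;z)$ and $\Theta(a,\gamma_ia;\gamma_jz)$ converge unconditionally and are nonzero, and $$\left|\frac{\Theta_m(a,\gamma_ia;z)/\Theta_m(a,\gamma_ia;\gamma_jz)}{\Theta(a,\gamma_ia;z)/\Theta(a,\gamma_ia;\gamma_jz)}-1\right|\le p^{-cm}.$$ -/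

import Mathlib

open scoped MatrixGroups

noncomputable section

namespace MumfordCurve

/-- Scalar matrices act trivially on the projective line `OnePoint K = K ∪ {∞}`. -/
theorem scalar_smul_onePoint {K : Type*} [Field K] [DecidableEq K] (u : Kˣ) (x : OnePoint K) :
    Matrix.GeneralLinearGroup.scalar (Fin 2) u • x = x := by
  induction x using OnePoint.rec with
  | infty => simp [OnePoint.smul_infty_eq_ite]
  | coe t => simp [OnePoint.smul_some_eq_ite]

open Classical in
/-- `PGL(2, K)` acts on `ℙ¹(K) = OnePoint K` by Möbius transformations. -/
instance instPGLAction {K : Type*} [Field K] : MulAction PGL(2, K) (OnePoint K) :=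
  Matrix.ProjGenLinGroup.mulActionOfGL scalar_smul_onePoint

/-- An element of `PGL(2, K)` is hyperbolic if a representing matrix has two eigenvalues
of different absolute value (this does not depend on the representing matrix). -/
def IsHyperbolic {K : Type*} [NormedField K] (δ : PGL(2, K)) : Prop :=
  ∃ A : GL (Fin 2) K, Matrix.ProjGenLinGroup.mk A = δ ∧
    ∃ s t : K, Module.End.HasEigenvalue (Matrix.toLin' (A : Matrix (Fin 2) (Fin 2) K)) s ∧
      Module.End.HasEigenvalue (Matrix.toLin' (A : Matrix (Fin 2) (Fin 2) K)) t ∧ ‖s‖ ≠ ‖t‖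

/-- A Schottky group: finitely generated, and every non-identity element is hyperbolic. -/
structure IsSchottky {K : Type*} [NormedField K] (Γ : Subgroup PGL(2, K)) : Prop where
  fg : Γ.FG
  hyperbolic : ∀ δ ∈ Γ, δ ≠ 1 → IsHyperbolic δ

/-- A ball in `ℙ¹(K)`, given by a centre `a : K`, a radius `r > 0` and a side: either the usual
side (not containing `∞`), or the side containing `∞`. -/
structure Ball (K : Type*) where
  center : K
  radius : ℝ
  radius_pos : 0 < radius
  atInfinity : Bool

/-- The open ball: `{x | |x - a| < r}` or `ℙ¹ ∖ {x | |x - a| ≤ r}`. -/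
def Ball.openSet {K : Type*} [NormedField K] (B : Ball K) : Set (OnePoint K) :=
  if B.atInfinity then ((↑) '' Metric.closedBall B.center B.radius : Set (OnePoint K))ᶜ
  else (↑) '' Metric.ball B.center B.radius

/-- The corresponding closed ball: `{x | |x - a| ≤ r}` or `ℙ¹ ∖ {x | |x - a| < r}`. -/
def Ball.closedSet {K : Type*} [NormedField K] (B : Ball K) : Set (OnePoint K) :=
  if B.atInfinity then ((↑) '' Metric.ball B.center B.radius : Set (OnePoint K))ᶜ
  else (↑) '' Metric.closedBall B.center B.radius

/-- The radius of the smallest usual closed ball that contains both `{x | |x - a| ≤ r}` and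
`{x | |x - b| ≤ s}`, where `a, r` and `b, s` are the centres and radii of `B` and `C`. -/
def joinRadius {K : Type*} [NormedField K] (B C : Ball K) : ℝ :=
  max (max B.radius C.radius) ‖B.center - C.center‖

/-- The distance (to base `p`) in `(ℙ¹)ᵃⁿ` between the points of type 2 or 3 that belong to two
balls. The point of a ball with centre `a` and radius `r` is the one of the usual closed ball
`{x | |x - a| ≤ r}`; for a ball on the side of `∞` this is the boundary point of the ball as well,
so that the definition is compatible with the action of `PGL(2, K)`.
The distance runs through the point of the smallest closed ball that contains both. -/
def pointDist {K : Type*} [NormedField K] (p : ℝ) (B C : Ball K) : ℝ :=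
  Real.logb p (joinRadius B C / B.radius) + Real.logb p (joinRadius B C / C.radius)

/-- The balls `B₁, …, B_g, B₁', …, B_g'` in one family. -/
def allBalls {K : Type*} {g : ℕ} (B B' : Fin g → Ball K) : Fin g ⊕ Fin g → Ball K :=
  Sum.elim B B'

/-- `c`: the smallest distance between two of the `2g` points in `(ℙ¹)ᵃⁿ`. -/
def minDist {K : Type*} [NormedField K] (p : ℝ) {g : ℕ} (B B' : Fin g → Ball K) : ℝ :=
  ⨅ q : {q : (Fin g ⊕ Fin g) × (Fin g ⊕ Fin g) // q.1 ≠ q.2},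
    pointDist p (allBalls B B' q.1.1) (allBalls B B' q.1.2)

/-- The balls `Bᵢ, Bᵢ'` define a good fundamental domain `ℙ¹ ∖ ⋃ (Bᵢ ∪ Bᵢ')` for `γ₁, …, γ_g`. -/
structure IsGoodFundamentalDomain {K : Type*} [NormedField K] {g : ℕ} (γ : Fin g → PGL(2, K))
    (B B' : Fin g → Ball K) : Prop where
  disjoint : Pairwise fun k l =>
    Disjoint (allBalls B B' k).closedSet (allBalls B B' l).closedSet
  image : ∀ i, (fun x => γ i • x) '' (B' i).openSetᶜ = (B i).closedSet
  image_inv : ∀ i, (fun x => (γ i)⁻¹ • x) '' (B i).openSetᶜ = (B' i).closedSet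

/-- The set of fixed points of the non-identity elements of `Γ`. -/
def fixedPts {K : Type*} [Field K] (Γ : Subgroup PGL(2, K)) : Set (OnePoint K) :=
  {x | ∃ δ ∈ Γ, δ ≠ 1 ∧ δ • x = x}

/-- The set `Σ` of bad points: fixed points of non-identity elements of `Γ` and their limit points,
in the topology of `ℙ¹(K)` generated by the open balls (for `K` not locally compact this is not
the topology that `OnePoint K` carries, so the closure is spelled out). -/
def badPts {K : Type*} [NormedField K] (Γ : Subgroup PGL(2, K)) : Set (OnePoint K) :=
  {x | ∀ U : Ball K, x ∈ U.openSet → (U.openSet ∩ fixedPts Γ).Nonempty}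

/-- `Γ_m`: the elements `h₁ ⋯ h_k` with `k ≤ m`, `h_l ∈ {γ₁^±, …, γ_g^±}`, `h_l ≠ h_{l+1}⁻¹`. -/
def wordBall {G : Type*} [Group G] {g : ℕ} (γ : Fin g → G) (m : ℕ) : Set G :=
  {δ | ∃ L : List (Fin g × Bool), L.length ≤ m ∧ FreeGroup.IsReduced L ∧
    FreeGroup.lift γ (FreeGroup.mk L) = δ}

theorem wordBall_finite {G : Type*} [Group G] {g : ℕ} (γ : Fin g → G) (m : ℕ) :
    (wordBall γ m).Finite :=
  ((List.finite_length_le (Fin g × Bool) m).image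
    fun L => FreeGroup.lift γ (FreeGroup.mk L)).subset
    fun _ ⟨L, hL, _, h⟩ => ⟨L, hL, h⟩

/-- The difference `x - y` on `ℙ¹(K)`: it is `x₁ y₂ - x₂ y₁` for the representatives
`x = (x : 1)` of a finite point and `∞ = (1 : 0)`. -/
def diff {K : Type*} [Field K] (x y : OnePoint K) : K :=
  x.elim (y.elim 0 fun _ => 1) fun s => y.elim (-1) fun t => s - t

/-- The factor `(z - a) / (z - b)` of a theta function. For finite points it is the literal
quotient; for finite `z`, if `a` or `b` is `∞`, its difference from `z` is replaced by the constant
`-1`; these constants cancel in quotients `factor a b z / factor a b w`, which are cross ratios. -/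
def factor {K : Type*} [Field K] (a b z : OnePoint K) : K :=
  diff z a / diff z b

/-- The truncated theta function `Θ_m(a, b; z) = ∏_{δ ∈ Γ_m} (z - δ a) / (z - δ b)`. -/
def thetaTrunc {K : Type*} [Field K] {g : ℕ} (γ : Fin g → PGL(2, K)) (m : ℕ)
    (a b z : OnePoint K) : K :=
  ∏ δ ∈ (wordBall_finite γ m).toFinset, factor (δ • a) (δ • b) z

/-- The theta function `Θ(a, b; z) = ∏_{δ ∈ Γ} (z - δ a) / (z - δ b)` (an unconditional product). -/
def theta {K : Type*} [NormedField K] (Γ : Subgroup PGL(2, K)) (a b z : OnePoint K) : K :=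
  ∏' δ : Γ, factor ((δ : PGL(2, K)) • a) ((δ : PGL(2, K)) • b) z

/-- The theta quotient `Θ(a, b; z) / Θ(a, b; w)` as one product of cross ratios
`∏_{δ ∈ Γ} ((z - δ a) / (z - δ b)) / ((w - δ a) / (w - δ b))`. It is meaningful also if `∞` is a
bad point, when the products for `Θ(a, b; z)` and `Θ(a, b; w)` need not converge separately. -/
def thetaQuot {K : Type*} [NormedField K] (Γ : Subgroup PGL(2, K)) (a b z w : OnePoint K) : K :=
  ∏' δ : Γ, factor ((δ : PGL(2, K)) • a) ((δ : PGL(2, K)) • b) z /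
    factor ((δ : PGL(2, K)) • a) ((δ : PGL(2, K)) • b) w

end MumfordCurve

end

/-!
Let `D h` be the ball into which the letter `h` maps the outside of the ball of `h⁻¹`. Seen from the
point `P_B` of `(ℙ¹)ᵃⁿ`, nearness of points of `ℙ¹` is measured by a chordal distance `d_B ≤ 1`, and
if `z, w ∈ B⁺` and `x, y ∈ C⁺` for disjoint closed balls, then `(z - x) (w - y) / ((z - y) (w - x))`
deviates from `1` by exactly `p ^ (-dist (P_B, P_C)) * d_B (z, w) * d_C (x, y)`. By invariance of
the cross ratio, a letter `h` therefore contracts chordal distances by `q = p ^ (-c)` when it maps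
`D k` into `D h`, and a reduced word of length `n` brings two points of the fundamental domain to
distance at most `q ^ (n - 1)`. Comparing the ball of the first letter with the balls around `z`
and `w`, after moving all four points by that letter, bounds the deviation from `1` of the factor of
the theta quotient at a word of length `n` by `q ^ (n - 1)`. In a complete ultrametric field this
yields convergence of the product and the estimate for its truncation to `n ≤ m`.

If `∞` is not a bad point, a single factor `(z - δ a) / (z - δ b)` is the cross ratio with `w = ∞`.
Translates of the fixed points of the letters come close to every point that long words can reach,
so some neighbourhood of `∞` is never reached by long words, and the same contraction estimate
applies.
-/

noncomputable section

namespace MumfordCurve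

section Projective

variable {K : Type*} [Field K] {z w x y : OnePoint K}

@[simp] theorem diff_infty_infty : diff (OnePoint.infty : OnePoint K) OnePoint.infty = 0 := rfl
@[simp] theorem diff_infty_coe (t : K) : diff OnePoint.infty (t : OnePoint K) = 1 := rfl
@[simp] theorem diff_coe_infty (t : K) : diff (t : OnePoint K) OnePoint.infty = -1 := rfl
@[simp] theorem diff_coe_coe (s t : K) : diff (s : OnePoint K) (t : OnePoint K) = s - t := rfl

theorem diff_eq_zero_iff : diff x y = 0 ↔ x = y := by
  induction x using OnePoint.rec <;> induction y using OnePoint.rec <;> simp [sub_eq_zero]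

theorem diff_comm (x y : OnePoint K) : diff x y = -diff y x := by
  induction x using OnePoint.rec <;> induction y using OnePoint.rec <;> simp

theorem diff_plucker (z w x y : OnePoint K) :
    diff z x * diff w y - diff z y * diff w x = diff z w * diff x y := by
  induction x using OnePoint.rec <;> induction y using OnePoint.rec <;>
    induction z using OnePoint.rec <;> induction w using OnePoint.rec <;> (simp; try ring)

/-- The homogeneous coordinates `(t : 1)` of a finite point `t` and `(1 : 0)` of `∞`, for which
`diff` is the determinant of a pair of points. -/
def homogCoord (x : OnePoint K) : Fin 2 → K := x.elim ![1, 0] fun t => ![t, 1]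

theorem diff_eq_homogCoord (x y : OnePoint K) :
    diff x y = homogCoord x 0 * homogCoord y 1 - homogCoord x 1 * homogCoord y 0 := by
  induction x using OnePoint.rec <;> induction y using OnePoint.rec <;> simp [homogCoord]

theorem homogCoord_ne_zero (x : OnePoint K) : homogCoord x ≠ 0 := by
  induction x using OnePoint.rec with
  | infty => exact fun h => one_ne_zero (congrFun h 0)
  | coe t => exact fun h => one_ne_zero (congrFun h 1)

open Classical in
theorem equivProjectivization_eq_mk (x : OnePoint K) :
    OnePoint.equivProjectivization K x = .mk K (homogCoord x) (homogCoord_ne_zero x) := by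
  induction x using OnePoint.rec with
  | infty => exact OnePoint.equivProjectivization_apply_infinity K
  | coe t => exact OnePoint.equivProjectivization_apply_coe K t

open Classical in
theorem exists_smul_homogCoord_smul (A : GL (Fin 2) K) (x : OnePoint K) :
    ∃ u : Kˣ, u • (A • homogCoord x) = homogCoord (A • x) := by
  have h := OnePoint.equivProjectivization_smul (g := A) x
  rwa [equivProjectivization_eq_mk, equivProjectivization_eq_mk, Projectivization.smul_mk,
    Projectivization.mk_eq_mk_iff] at h

theorem exists_diff_smul (δ : PGL(2, K)) :
    ∃ (k : Kˣ) (j : OnePoint K → Kˣ),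
      ∀ x y, diff (δ • x) (δ • y) = k * (j x * j y) * diff x y := by
  classical
  obtain ⟨A, rfl⟩ := Matrix.ProjGenLinGroup.mk_surjective δ
  choose j hj using exists_smul_homogCoord_smul A
  refine ⟨A.det, j, fun x y => ?_⟩
  change diff (A • x) (A • y) = _
  simp only [diff_eq_homogCoord, ← hj, Matrix.GeneralLinearGroup.fin_two_smul, Pi.smul_apply]
  simp only [Units.smul_def, smul_eq_mul, Matrix.GeneralLinearGroup.val_det_apply,
    Matrix.det_fin_two, Matrix.cons_val_zero, Matrix.cons_val_one]
  ring

/-- The cross ratio of two pairs of points, normalised to vanish if `z = w` or `x = y`: it is the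
deviation from `1` of `(z - x) (w - y) / ((z - y) (w - x))`. -/
def crossRatio (z w x y : OnePoint K) : K :=
  diff z w * diff x y / (diff z y * diff w x)

theorem crossRatio_smul (δ : PGL(2, K)) (z w x y : OnePoint K) :
    crossRatio (δ • z) (δ • w) (δ • x) (δ • y) = crossRatio z w x y := by
  obtain ⟨k, j, h⟩ := exists_diff_smul δ
  have hu : (k ^ 2 * j z * j w * j x * j y : K) ≠ 0 := by simp
  simp only [crossRatio, h]
  rw [← mul_div_mul_left (diff z w * diff x y) _ hu]
  congr 1 <;> ring

theorem factor_ne_zero (hx : z ≠ x) (hy : z ≠ y) : factor x y z ≠ 0 :=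
  div_ne_zero (mt diff_eq_zero_iff.1 hx) (mt diff_eq_zero_iff.1 hy)

theorem factor_div_factor_sub_one (hzy : z ≠ y) (hwx : w ≠ x) (hwy : w ≠ y) :
    factor x y z / factor x y w - 1 = crossRatio z w x y := by
  have := mt diff_eq_zero_iff.1 hzy
  have := mt diff_eq_zero_iff.1 hwx
  have := mt diff_eq_zero_iff.1 hwy
  rw [crossRatio, ← diff_plucker, factor, factor]
  field_simp

theorem factor_infty (hx : x ≠ OnePoint.infty) (hy : y ≠ OnePoint.infty) :
    factor x y OnePoint.infty = 1 := by
  lift x to K using hx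
  lift y to K using hy
  simp [factor]

end Projective

section Ultrametric

variable {E : Type*} [SeminormedAddCommGroup E] [IsUltrametricDist E] {u v : E}

theorem norm_sub_le_max (u v : E) : ‖u - v‖ ≤ max ‖u‖ ‖v‖ := by
  simpa only [sub_eq_add_neg, norm_neg] using IsUltrametricDist.norm_add_le_max u (-v)

theorem norm_eq_of_norm_sub_lt (h : ‖u - v‖ < ‖v‖) : ‖u‖ = ‖v‖ := by
  rw [sub_eq_add_neg] at h
  simpa only [norm_neg] using IsUltrametricDist.norm_eq_of_add_norm_lt_max
    (h.trans_le ((norm_neg v).ge.trans (le_max_right ‖u‖ ‖-v‖)))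

end Ultrametric

section Ball

variable {K : Type*} [NormedField K] (B C : Ball K) {x y z w : OnePoint K}

theorem norm_diff_comm (x y : OnePoint K) : ‖diff x y‖ = ‖diff y x‖ := by
  rw [diff_comm, norm_neg]

namespace Ball

theorem mem_closedSet_iff : x ∈ B.closedSet ↔
    if B.atInfinity then B.radius * ‖diff x OnePoint.infty‖ ≤ ‖diff x B.center‖
    else ‖diff x B.center‖ ≤ B.radius * ‖diff x OnePoint.infty‖ := by
  unfold closedSet
  split_ifs <;> induction x using OnePoint.rec <;> simp [dist_eq_norm]

theorem mem_openSet_iff : x ∈ B.openSet ↔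
    if B.atInfinity then B.radius * ‖diff x OnePoint.infty‖ < ‖diff x B.center‖
    else ‖diff x B.center‖ < B.radius * ‖diff x OnePoint.infty‖ := by
  unfold openSet
  split_ifs <;> induction x using OnePoint.rec <;> simp [dist_eq_norm]

theorem openSet_subset_closedSet : B.openSet ⊆ B.closedSet := by
  intro x hx
  rw [mem_closedSet_iff]
  rw [mem_openSet_iff] at hx
  split_ifs at hx ⊢ <;> exact hx.le

theorem infty_mem_closedSet (hB : B.atInfinity) : OnePoint.infty ∈ B.closedSet := by
  simp [mem_closedSet_iff, hB]

theorem ne_infty_of_mem_closedSet (hB : ¬ B.atInfinity) (hx : x ∈ B.closedSet) :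
    x ≠ OnePoint.infty := by
  rintro rfl
  norm_num [mem_closedSet_iff, hB] at hx

/-- The Gauss norm `max |x - c| r` on the disc with the centre `c` and the radius `r` of `B`,
extended to `ℙ¹` through the homogeneous coordinates behind `diff`; it does not depend on the side
of `B`. -/
def gaussNorm (x : OnePoint K) : ℝ :=
  max ‖diff x B.center‖ (B.radius * ‖diff x OnePoint.infty‖)

@[simp] theorem gaussNorm_infty : B.gaussNorm OnePoint.infty = 1 := by simp [gaussNorm]

@[simp] theorem gaussNorm_coe (t : K) :
    B.gaussNorm t = max ‖t - B.center‖ B.radius := by simp [gaussNorm]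

theorem gaussNorm_pos (x : OnePoint K) : 0 < B.gaussNorm x := by
  induction x using OnePoint.rec <;> simp [B.radius_pos]

theorem gaussNorm_of_mem_closedSet (hx : x ∈ B.closedSet) : B.gaussNorm x =
    if B.atInfinity then ‖diff x B.center‖ else B.radius * ‖diff x OnePoint.infty‖ := by
  rw [mem_closedSet_iff] at hx
  split_ifs at hx ⊢
  exacts [max_eq_left hx, max_eq_right hx]

/-- The chordal distance on `ℙ¹` in the coordinate `(x - c) / r` given by the centre and the radius
of `B`, which measures how close two points are as seen from the point of `B` in `(ℙ¹)ᵃⁿ`. -/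
def chordal (x y : OnePoint K) : ℝ :=
  B.radius * ‖diff x y‖ / (B.gaussNorm x * B.gaussNorm y)

theorem chordal_nonneg (x y : OnePoint K) : 0 ≤ B.chordal x y := by
  have := B.radius_pos
  have := B.gaussNorm_pos x
  have := B.gaussNorm_pos y
  unfold chordal
  positivity

theorem chordal_comm (x y : OnePoint K) : B.chordal x y = B.chordal y x := by
  rw [chordal, chordal, norm_diff_comm, mul_comm (B.gaussNorm x)]

theorem norm_diff_eq_chordal (x y : OnePoint K) :
    ‖diff x y‖ = B.chordal x y * B.gaussNorm x * B.gaussNorm y / B.radius := by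
  have := B.radius_pos.ne'
  have := (B.gaussNorm_pos x).ne'
  have := (B.gaussNorm_pos y).ne'
  unfold chordal
  field_simp

theorem chordal_le_one [IsUltrametricDist K] (x y : OnePoint K) : B.chordal x y ≤ 1 := by
  have hr := B.radius_pos.le
  have plucker : diff x y = diff y B.center * diff x OnePoint.infty -
      diff x B.center * diff y OnePoint.infty := by
    have := diff_plucker (B.center : OnePoint K) OnePoint.infty x y
    rw [diff_coe_infty, diff_comm _ x, diff_comm _ y, diff_comm _ x, diff_comm _ y] at this
    linear_combination this
  refine div_le_one_of_le₀ ?_ (mul_nonneg (B.gaussNorm_pos x).le (B.gaussNorm_pos y).le)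
  calc B.radius * ‖diff x y‖
      ≤ B.radius * max ‖diff y B.center * diff x OnePoint.infty‖
          ‖diff x B.center * diff y OnePoint.infty‖ := by
        rw [plucker]
        exact mul_le_mul_of_nonneg_left (norm_sub_le_max _ _) hr
    _ = max (B.radius * ‖diff x OnePoint.infty‖ * ‖diff y B.center‖)
          (‖diff x B.center‖ * (B.radius * ‖diff y OnePoint.infty‖)) := by
        rw [mul_max_of_nonneg _ _ hr, norm_mul, norm_mul]
        congr 1 <;> ring
    _ ≤ B.gaussNorm x * B.gaussNorm y := by
        have := B.gaussNorm_pos x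
        refine max_le ?_ ?_ <;> unfold gaussNorm at * <;> gcongr <;> simp

end Ball

theorem joinRadius_comm : joinRadius B C = joinRadius C B := by
  rw [joinRadius, joinRadius, max_comm B.radius, norm_sub_rev]

theorem joinRadius_pos : 0 < joinRadius B C :=
  lt_max_of_lt_left (lt_max_of_lt_left B.radius_pos)

/-- The number `r s / R²` for balls of radii `r` and `s` in a smallest common disc of radius `R`,
which is `p` to the power minus the distance of the points of the two balls. -/
def ballRatio : ℝ := B.radius * C.radius / joinRadius B C ^ 2

theorem ballRatio_nonneg : 0 ≤ ballRatio B C :=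
  div_nonneg (mul_nonneg B.radius_pos.le C.radius_pos.le) (sq_nonneg _)

theorem rpow_neg_pointDist {p : ℝ} (hp : 1 < p) : p ^ (-pointDist p B C) = ballRatio B C := by
  have h := joinRadius_pos B C
  have hB := B.radius_pos
  have hC := C.radius_pos
  rw [pointDist, ← Real.logb_mul (by positivity) (by positivity), ← Real.logb_inv,
    Real.rpow_logb (by linarith) hp.ne' (by positivity), ballRatio]
  field_simp

variable {B C}

theorem Ball.mem_openSet_of_chordal_infty_lt [IsUltrametricDist K] (hC : OnePoint.infty ∈ C.openSet)
    (hy : B.chordal OnePoint.infty y < B.radius / joinRadius B C) : y ∈ C.openSet := by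
  have hCinf : C.atInfinity := by
    by_contra h
    exact C.ne_infty_of_mem_closedSet h (C.openSet_subset_closedSet hC) rfl
  contrapose! hy
  rw [mem_openSet_iff, if_pos hCinf, not_lt] at hy
  induction y using OnePoint.rec with
  | infty => norm_num at hy
  | coe t =>
    have hJ : B.gaussNorm t ≤ joinRadius B C := by
      have ht : ‖t - C.center‖ ≤ C.radius := by simpa using hy
      rw [gaussNorm_coe, joinRadius, ← sub_sub_sub_cancel_right t B.center C.center]
      refine max_le ((norm_sub_le_max _ _).trans (max_le_max (ht.trans (le_max_right _ _)) le_rfl))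
        (le_max_of_le_left (le_max_left _ _))
    have := B.radius_pos.le
    have := B.gaussNorm_pos t
    simp only [chordal, diff_infty_coe, norm_one, mul_one, gaussNorm_infty, one_mul]
    gcongr

namespace Ball

/-- The closed balls are disjoint and the open balls do not cover `ℙ¹`. -/
structure Separated (B C : Ball K) : Prop where
  disjoint : Disjoint B.closedSet C.closedSet
  exists_notMem : ∃ o, o ∉ B.openSet ∧ o ∉ C.openSet

theorem Separated.symm (h : B.Separated C) : C.Separated B :=
  ⟨h.disjoint.symm, h.exists_notMem.imp fun _ => And.symm⟩

theorem Separated.notMem_openSet (h : B.Separated C) (hx : x ∈ B.closedSet) : x ∉ C.openSet :=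
  fun hxC => Set.disjoint_left.1 h.disjoint hx (C.openSet_subset_closedSet hxC)

theorem Separated.radius_lt_norm_center_sub (h : B.Separated C) (hB : ¬ B.atInfinity)
    (hC : ¬ C.atInfinity) : B.radius < ‖B.center - C.center‖ := by
  have hc : (C.center : OnePoint K) ∈ C.closedSet := by
    simp [mem_closedSet_iff, hC, C.radius_pos.le]
  simpa [mem_closedSet_iff, hB, norm_sub_rev] using Set.disjoint_right.1 h.disjoint hc

theorem Separated.norm_center_sub_lt_radius (h : B.Separated C) (hB : B.atInfinity)
    (hC : ¬ C.atInfinity) : ‖B.center - C.center‖ < B.radius := by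
  have hc : (C.center : OnePoint K) ∈ C.closedSet := by
    simp [mem_closedSet_iff, hC, C.radius_pos.le]
  simpa [mem_closedSet_iff, hB, norm_sub_rev] using Set.disjoint_right.1 h.disjoint hc

variable [IsUltrametricDist K]

theorem Separated.radius_lt_radius (h : B.Separated C) (hB : B.atInfinity)
    (hC : ¬ C.atInfinity) : C.radius < B.radius := by
  obtain ⟨o, hoB, hoC⟩ := h.exists_notMem
  have hoBC : o ∈ B.closedSet → o ∉ C.closedSet := fun hB hC => Set.disjoint_left.1 h.disjoint hB hC
  have hcen := norm_sub_rev C.center B.center ▸ h.norm_center_sub_lt_radius hB hC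
  rw [mem_openSet_iff, if_pos hB, not_lt] at hoB
  rw [mem_openSet_iff, if_neg hC, not_lt] at hoC
  rw [mem_closedSet_iff, mem_closedSet_iff, if_pos hB, if_neg hC, not_le] at hoBC
  induction o using OnePoint.rec with
  | infty => norm_num at hoB
  | coe t =>
    simp only [diff_coe_infty, norm_neg, norm_one, mul_one, diff_coe_coe] at hoB hoC hoBC
    have htri : ‖t - C.center‖ ≤ max ‖t - B.center‖ ‖C.center - B.center‖ :=
      sub_sub_sub_cancel_right t C.center B.center ▸ norm_sub_le_max _ _
    rcases le_or_gt B.radius ‖t - B.center‖ with ht | ht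
    · exact (hoBC ht).trans_le (htri.trans (max_le hoB hcen.le))
    · exact hoC.trans_lt (htri.trans_lt (max_lt ht hcen))

theorem Separated.radius_lt_joinRadius (h : B.Separated C) (hC : ¬ C.atInfinity) :
    C.radius < joinRadius B C := by
  by_cases hB : B.atInfinity
  · exact (h.radius_lt_radius hB hC).trans_le (le_max_of_le_left (le_max_left _ _))
  · rw [joinRadius_comm]
    exact (h.symm.radius_lt_norm_center_sub hC hB).trans_le (le_max_right _ _)

theorem Separated.ballRatio_lt_one (h : B.Separated C) : ballRatio B C < 1 := by
  have hB : B.radius ≤ joinRadius B C := le_max_of_le_left (le_max_left _ _)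
  have hC : C.radius ≤ joinRadius B C := le_max_of_le_left (le_max_right _ _)
  rw [ballRatio, div_lt_one (pow_pos (joinRadius_pos B C) 2), pow_two]
  by_cases hCinf : C.atInfinity
  · have hBinf : ¬ B.atInfinity := fun hBinf => Set.disjoint_left.1 h.disjoint
      (B.infty_mem_closedSet hBinf) (C.infty_mem_closedSet hCinf)
    exact mul_lt_mul (joinRadius_comm B C ▸ h.symm.radius_lt_joinRadius hBinf) hC C.radius_pos
      (joinRadius_pos B C).le
  · exact mul_lt_mul' hB (h.radius_lt_joinRadius hCinf) C.radius_pos.le (joinRadius_pos B C)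

theorem Separated.norm_diff_of_finite (h : B.Separated C) (hB : ¬ B.atInfinity)
    (hC : ¬ C.atInfinity) (hx : x ∈ B.closedSet) (hy : y ∈ C.closedSet) :
    B.radius * C.radius * ‖diff x y‖ = joinRadius B C * B.gaussNorm x * C.gaussNorm y := by
  have hBC := h.radius_lt_norm_center_sub hB hC
  have hCB := norm_sub_rev C.center B.center ▸ h.symm.radius_lt_norm_center_sub hC hB
  rw [B.gaussNorm_of_mem_closedSet hx, C.gaussNorm_of_mem_closedSet hy, if_neg hB, if_neg hC,
    joinRadius, max_eq_right (max_le hBC.le hCB.le)]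
  lift x to K using B.ne_infty_of_mem_closedSet hB hx
  lift y to K using C.ne_infty_of_mem_closedSet hC hy
  have hx' : ‖x - B.center‖ ≤ B.radius := by simpa [mem_closedSet_iff, hB] using hx
  have hy' : ‖y - C.center‖ ≤ C.radius := by simpa [mem_closedSet_iff, hC] using hy
  have hxy : ‖x - y‖ = ‖B.center - C.center‖ := norm_eq_of_norm_sub_lt <| by
    rw [show x - y - (B.center - C.center) = x - B.center - (y - C.center) by ring]
    exact (norm_sub_le_max _ _).trans_lt (max_lt (hx'.trans_lt hBC) (hy'.trans_lt hCB))
  simp only [diff_coe_coe, diff_coe_infty, norm_neg, norm_one, hxy]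
  ring

theorem Separated.norm_diff_of_atInfinity (h : B.Separated C) (hB : B.atInfinity)
    (hC : ¬ C.atInfinity) (hx : x ∈ B.closedSet) (hy : y ∈ C.closedSet) :
    B.radius * C.radius * ‖diff x y‖ = joinRadius B C * B.gaussNorm x * C.gaussNorm y := by
  rw [B.gaussNorm_of_mem_closedSet hx, C.gaussNorm_of_mem_closedSet hy, if_pos hB, if_neg hC,
    joinRadius, max_eq_left (h.radius_lt_radius hB hC).le,
    max_eq_left (h.norm_center_sub_lt_radius hB hC).le]
  lift y to K using C.ne_infty_of_mem_closedSet hC hy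
  have hyB : ‖y - B.center‖ < B.radius := by
    simpa [mem_closedSet_iff, hB] using Set.disjoint_right.1 h.disjoint hy
  have hxy : ‖diff x y‖ = ‖diff x B.center‖ := by
    induction x using OnePoint.rec with
    | infty => simp
    | coe x =>
      have hx' : B.radius ≤ ‖x - B.center‖ := by simpa [mem_closedSet_iff, hB] using hx
      refine norm_eq_of_norm_sub_lt ?_
      simpa [norm_sub_rev] using hyB.trans_le hx'
  simp only [diff_coe_infty, norm_neg, norm_one, hxy]
  ring

theorem Separated.norm_diff (h : B.Separated C) (hx : x ∈ B.closedSet) (hy : y ∈ C.closedSet) :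
    B.radius * C.radius * ‖diff x y‖ = joinRadius B C * B.gaussNorm x * C.gaussNorm y := by
  by_cases hB : B.atInfinity <;> by_cases hC : C.atInfinity
  · exact (Set.disjoint_left.1 h.disjoint (B.infty_mem_closedSet hB)
      (C.infty_mem_closedSet hC)).elim
  · exact h.norm_diff_of_atInfinity hB hC hx hy
  · have := h.symm.norm_diff_of_atInfinity hC hB hy hx
    rw [norm_diff_comm, joinRadius_comm]
    linear_combination this
  · exact h.norm_diff_of_finite hB hC hx hy

theorem Separated.norm_crossRatio (h : B.Separated C) (hz : z ∈ B.closedSet)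
    (hw : w ∈ B.closedSet) (hx : x ∈ C.closedSet) (hy : y ∈ C.closedSet) :
    ‖crossRatio z w x y‖ = ballRatio B C * B.chordal z w * C.chordal x y := by
  have hB := B.radius_pos
  have hC := C.radius_pos
  have hJ := joinRadius_pos B C
  have hgz := B.gaussNorm_pos z
  have hgw := B.gaussNorm_pos w
  have hgx := C.gaussNorm_pos x
  have hgy := C.gaussNorm_pos y
  have hzy : ‖diff z y‖ = joinRadius B C * B.gaussNorm z * C.gaussNorm y / (B.radius * C.radius) :=
    by rw [← h.norm_diff hz hy]; field_simp
  have hwx : ‖diff w x‖ = joinRadius B C * B.gaussNorm w * C.gaussNorm x / (B.radius * C.radius) :=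
    by rw [← h.norm_diff hw hx]; field_simp
  rw [crossRatio, norm_div, norm_mul, norm_mul, hzy, hwx, B.norm_diff_eq_chordal z w,
    C.norm_diff_eq_chordal x y, ballRatio]
  field_simp

end Ball

end Ball

namespace Ball

section Recovery

variable {K : Type*} [DenselyNormedField K] [IsUltrametricDist K] {C : Ball K} {x y : OnePoint K}

theorem exists_lt_chordal (C : Ball K) {t : ℝ} (ht : 0 < t) (ht1 : t < 1) :
    ∃ z w, z ∉ C.openSet ∧ w ∉ C.openSet ∧ t < C.chordal z w ∧ ∀ x ∈ C.closedSet,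
      C.chordal z x = 1 ∧ C.chordal w x = 1 := by
  have hr := C.radius_pos
  by_cases hC : C.atInfinity
  · obtain ⟨u, hu, hur⟩ := NormedField.exists_lt_norm_lt K (mul_nonneg ht.le hr.le)
      (mul_lt_of_lt_one_left hr ht1)
    refine ⟨C.center, (C.center + u : K), by simp [mem_openSet_iff, hC, hr.le],
      by simp [mem_openSet_iff, hC, hur.le], ?_, fun x hx => ?_⟩
    · simp only [chordal, gaussNorm_coe, diff_coe_coe, sub_self, norm_zero, add_sub_cancel_left,
        sub_add_cancel_left, norm_neg, max_eq_right hr.le, max_eq_right hur.le]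
      rwa [mul_div_mul_left _ _ hr.ne', lt_div_iff₀ hr]
    · have hgx := C.gaussNorm_of_mem_closedSet hx
      have hgx0 := C.gaussNorm_pos x
      rw [if_pos hC] at hgx
      have hwx : ‖diff x (C.center + u : K)‖ = ‖diff x C.center‖ := by
        induction x using OnePoint.rec with
        | infty => simp
        | coe x =>
          have hx' : C.radius ≤ ‖x - C.center‖ := by simpa [mem_closedSet_iff, hC] using hx
          refine norm_eq_of_norm_sub_lt ?_
          simpa using hur.trans_le hx'
      constructor <;> rw [chordal_comm, chordal, gaussNorm_coe]
      · simp [hr.le, ← hgx, mul_comm, hr.ne', hgx0.ne']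
      · simp [hwx, hur.le, ← hgx, mul_comm, hr.ne', hgx0.ne']
  · obtain ⟨u, hru, hu⟩ := NormedField.exists_lt_norm_lt K hr.le ((lt_div_iff₀ ht).2
      (mul_lt_of_lt_one_right hr ht1))
    refine ⟨OnePoint.infty, (C.center + u : K), by simp [mem_openSet_iff, hC],
      by simp [mem_openSet_iff, hC, hru.le], ?_, fun x hx => ?_⟩
    · simp only [chordal, gaussNorm_coe, gaussNorm_infty, diff_infty_coe, add_sub_cancel_left,
        norm_one, mul_one, one_mul, max_eq_left hru.le]
      rwa [lt_div_comm₀ ht (hr.trans hru)]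
    · lift x to K using C.ne_infty_of_mem_closedSet hC hx
      have hx' : ‖x - C.center‖ ≤ C.radius := by simpa [mem_closedSet_iff, hC] using hx
      have hwx : ‖C.center + u - x‖ = ‖u‖ := norm_eq_of_norm_sub_lt <| by
        rw [add_sub_right_comm, add_sub_cancel_right, norm_sub_rev]
        exact hx'.trans_lt hru
      simp [chordal, hx', hwx, hru.le, hr.ne', (hr.trans hru).ne', mul_comm]

theorem chordal_le_of_forall_norm_crossRatio_le (hx : x ∈ C.closedSet) (hy : y ∈ C.closedSet)
    {M : ℝ} (h : ∀ z w, z ∉ C.openSet → w ∉ C.openSet → ‖crossRatio z w x y‖ ≤ M) :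
    C.chordal x y ≤ M := by
  have key : ∀ t : ℝ, 0 < t → t < 1 → t * C.chordal x y ≤ M := by
    intro t ht ht1
    obtain ⟨z, w, hz, hw, htzw, hzw⟩ := C.exists_lt_chordal ht ht1
    have hr := C.radius_pos
    have := C.gaussNorm_pos x
    have := C.gaussNorm_pos y
    have := C.gaussNorm_pos z
    have := C.gaussNorm_pos w
    calc t * C.chordal x y ≤ C.chordal z w * C.chordal x y :=
          mul_le_mul_of_nonneg_right htzw.le (C.chordal_nonneg x y)
      _ = ‖crossRatio z w x y‖ := by
          rw [crossRatio, norm_div, norm_mul, norm_mul, C.norm_diff_eq_chordal z w,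
            C.norm_diff_eq_chordal x y, C.norm_diff_eq_chordal z y, C.norm_diff_eq_chordal w x,
            (hzw y hy).1, (hzw x hx).2]
          field_simp
      _ ≤ M := h z w hz hw
  have hlim : Filter.Tendsto (· * C.chordal x y) (nhdsWithin 1 (Set.Iio 1))
      (nhds (1 * C.chordal x y)) :=
    ((continuous_mul_const _).tendsto 1).mono_left nhdsWithin_le_nhds
  rw [one_mul] at hlim
  exact le_of_tendsto hlim
    (Filter.mem_of_superset (Ioo_mem_nhdsLT one_pos) fun t ht => key t ht.1 ht.2)

end Recovery

section FixedPoint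

variable {K : Type*} [NormedField K] (B : Ball K)

theorem exists_chart_of_finite (hB : ¬ B.atInfinity) : ∃ ψ : K → OnePoint K,
    Set.MapsTo ψ (Metric.closedBall 0 B.radius) B.closedSet ∧
    Set.SurjOn ψ (Metric.closedBall 0 B.radius) B.closedSet ∧
    ∀ s ∈ Metric.closedBall (0 : K) B.radius, ∀ t ∈ Metric.closedBall (0 : K) B.radius,
      ‖s - t‖ = B.radius * B.chordal (ψ s) (ψ t) := by
  refine ⟨fun s => (B.center + s : K), fun s hs => ?_, fun x hx => ?_, fun s hs t ht => ?_⟩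
  · simpa [mem_closedSet_iff, hB] using hs
  · lift x to K using B.ne_infty_of_mem_closedSet hB hx
    exact ⟨x - B.center, by simpa [mem_closedSet_iff, hB] using hx, by simp⟩
  · rw [mem_closedBall_zero_iff] at hs ht
    have := B.radius_pos
    simp only [chordal, gaussNorm_coe, diff_coe_coe, add_sub_add_left_eq_sub, add_sub_cancel_left,
      max_eq_right hs, max_eq_right ht]
    field_simp

open Classical in
theorem exists_chart_of_atInfinity (hB : B.atInfinity) : ∃ ψ : K → OnePoint K,
    Set.MapsTo ψ (Metric.closedBall 0 B.radius⁻¹) B.closedSet ∧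
    Set.SurjOn ψ (Metric.closedBall 0 B.radius⁻¹) B.closedSet ∧
    ∀ s ∈ Metric.closedBall (0 : K) B.radius⁻¹, ∀ t ∈ Metric.closedBall (0 : K) B.radius⁻¹,
      ‖s - t‖ = B.radius⁻¹ * B.chordal (ψ s) (ψ t) := by
  have hr := B.radius_pos
  have radius_le {s : K} (hs : s ∈ Metric.closedBall 0 B.radius⁻¹) (hs0 : s ≠ 0) :
      B.radius ≤ ‖s‖⁻¹ := by
    rw [mem_closedBall_zero_iff] at hs
    rwa [le_inv_comm₀ hr (norm_pos_iff.2 hs0)]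
  refine ⟨fun s => if s = 0 then OnePoint.infty else (B.center + s⁻¹ : K), fun s hs => ?_,
    fun x hx => ?_, fun s hs t ht => ?_⟩
  · by_cases hs0 : s = 0
    · simp [hs0, B.infty_mem_closedSet hB]
    · simpa [hs0, mem_closedSet_iff, hB] using radius_le hs hs0
  · induction x using OnePoint.rec with
    | infty => exact ⟨0, by simp [hr.le], by simp⟩
    | coe x =>
      have hx' : B.radius ≤ ‖x - B.center‖ := by simpa [mem_closedSet_iff, hB] using hx
      refine ⟨(x - B.center)⁻¹, ?_, ?_⟩
      · rw [mem_closedBall_zero_iff, norm_inv]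
        exact inv_anti₀ hr hx'
      · simp [norm_pos_iff.1 (hr.trans_le hx')]
  · by_cases hs0 : s = 0 <;> by_cases ht0 : t = 0
    · simp [hs0, ht0, chordal]
    · simp [hs0, ht0, chordal, hr.ne', max_eq_left (radius_le ht ht0)]
    · simp [hs0, ht0, chordal, hr.ne', max_eq_left (radius_le hs hs0)]
    · have hs' := radius_le hs hs0
      have ht' := radius_le ht ht0
      simp only [hs0, ht0, if_false, chordal, gaussNorm_coe, diff_coe_coe, add_sub_add_left_eq_sub,
        add_sub_cancel_left, norm_inv, max_eq_left hs', max_eq_left ht', inv_sub_inv hs0 ht0,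
        norm_div, norm_mul, norm_sub_rev t s]
      have := norm_ne_zero_iff.2 hs0
      have := norm_ne_zero_iff.2 ht0
      field_simp

theorem exists_chart : ∃ (ψ : K → OnePoint K) (ρ : ℝ), 0 < ρ ∧
    Set.MapsTo ψ (Metric.closedBall 0 ρ) B.closedSet ∧
    Set.SurjOn ψ (Metric.closedBall 0 ρ) B.closedSet ∧
    ∀ s ∈ Metric.closedBall (0 : K) ρ, ∀ t ∈ Metric.closedBall (0 : K) ρ,
      ‖s - t‖ = ρ * B.chordal (ψ s) (ψ t) := by
  by_cases hB : B.atInfinity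
  · exact (B.exists_chart_of_atInfinity hB).imp fun ψ h => ⟨_, inv_pos.2 B.radius_pos, h⟩
  · exact (B.exists_chart_of_finite hB).imp fun ψ h => ⟨_, B.radius_pos, h⟩

variable {B}

theorem exists_fixedPoint [CompleteSpace K] {f : OnePoint K → OnePoint K} {q : ℝ} (hq0 : 0 ≤ q)
    (hq : q < 1) (hf : Set.MapsTo f B.closedSet B.closedSet)
    (hfq : ∀ x ∈ B.closedSet, ∀ y ∈ B.closedSet, B.chordal (f x) (f y) ≤ q * B.chordal x y) :
    ∃ x ∈ B.closedSet, f x = x := by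
  obtain ⟨ψ, ρ, hρ, hmaps, hsurj, hdist⟩ := B.exists_chart
  have lift_exists (s : K) : ∃ t, s ∈ Metric.closedBall 0 ρ →
      t ∈ Metric.closedBall 0 ρ ∧ ψ t = f (ψ s) := by
    by_cases hs : s ∈ Metric.closedBall 0 ρ
    · exact (hsurj (hf (hmaps hs))).imp fun t ht _ => ht
    · exact ⟨0, fun h => (hs h).elim⟩
  choose g hg using lift_exists
  have hgmaps : Set.MapsTo g (Metric.closedBall 0 ρ) (Metric.closedBall 0 ρ) :=
    fun s hs => (hg s hs).1
  have hcontr : ContractingWith ⟨q, hq0⟩ (hgmaps.restrict g _ _) := by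
    refine ⟨hq, LipschitzWith.of_dist_le_mul fun s t => ?_⟩
    rw [Subtype.dist_eq, Subtype.dist_eq, dist_eq_norm, dist_eq_norm]
    change ‖g s - g t‖ ≤ q * ‖(s : K) - t‖
    rw [hdist _ (hgmaps s.2) _ (hgmaps t.2), hdist _ s.2 _ t.2, (hg s s.2).2, (hg t t.2).2,
      mul_left_comm]
    exact mul_le_mul_of_nonneg_left (hfq _ (hmaps s.2) _ (hmaps t.2)) hρ.le
  obtain ⟨s, hs, hgs, -⟩ := hcontr.exists_fixedPoint' Metric.isClosed_closedBall.isComplete hgmaps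
    (Metric.mem_closedBall_self hρ.le) (edist_ne_top _ _)
  exact ⟨ψ s, hmaps hs, by rw [← (hg s hs).2, hgs]⟩

end FixedPoint

end Ball

theorem exists_lt_norm_lt_of_isAlgClosed (K : Type*) [NontriviallyNormedField K] [IsAlgClosed K]
    {x y : ℝ} (hx : 0 ≤ x) (hxy : x < y) : ∃ a : K, x < ‖a‖ ∧ ‖a‖ < y := by
  obtain ⟨x', hxx', hxy'⟩ := exists_between hxy
  have hx' : 0 < x' := hx.trans_lt hxx'
  obtain ⟨b, hb⟩ := NormedField.exists_one_lt_norm K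
  obtain ⟨n, hn⟩ := pow_unbounded_of_one_lt ‖b‖ ((one_lt_div hx').2 hxy')
  have hn0 : n ≠ 0 := by
    rintro rfl
    exact hb.not_gt (by simpa using hn)
  obtain ⟨a, rfl⟩ := IsAlgClosed.exists_pow_nat_eq b (Nat.pos_of_ne_zero hn0)
  rw [norm_pow] at hb hn
  have ha : 1 < ‖a‖ := (one_lt_pow_iff_of_nonneg (norm_nonneg a) hn0).1 hb
  have hay : ‖a‖ < y / x' :=
    lt_of_pow_lt_pow_left₀ n (div_nonneg (hx.trans hxy.le) hx'.le) hn
  obtain ⟨k, hk, hk'⟩ := exists_mem_Ico_zpow hx' ha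
  refine ⟨a ^ (k + 1), by simpa only [norm_zpow] using hxx'.trans hk', ?_⟩
  calc ‖a ^ (k + 1)‖ = ‖a‖ ^ k * ‖a‖ := by rw [norm_zpow, zpow_add_one₀ (one_pos.trans ha).ne']
    _ ≤ x' * ‖a‖ := mul_le_mul_of_nonneg_right hk (norm_nonneg a)
    _ < y := by rwa [lt_div_iff₀' hx'] at hay

section Words

variable {ι G : Type*} [Group G] {γ : ι → G} {Γ : Subgroup G}

/-- The inverse of a letter, where the letters `(i, true)` and `(i, false)` stand for a generator
and its inverse. -/
def invLetter (h : ι × Bool) : ι × Bool := (h.1, !h.2)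

@[simp] theorem invLetter_invLetter (h : ι × Bool) : invLetter (invLetter h) = h := by
  simp [invLetter]

theorem ne_invLetter {h k : ι × Bool} (hk : h.1 = k.1 → h.2 = k.2) : k ≠ invLetter h := by
  rintro rfl
  simp [invLetter] at hk

/-- The group element spelled by a word in the generators `γ i` and their inverses. -/
def word (γ : ι → G) (L : List (ι × Bool)) : G := FreeGroup.lift γ (FreeGroup.mk L)

@[simp] theorem word_nil : word γ [] = 1 := rfl

theorem word_append (γ : ι → G) (L M : List (ι × Bool)) :
    word γ (L ++ M) = word γ L * word γ M := by
  rw [word, ← FreeGroup.mul_mk, map_mul, word, word]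

theorem word_cons (γ : ι → G) (h : ι × Bool) (L : List (ι × Bool)) :
    word γ (h :: L) = word γ [h] * word γ L := word_append γ [h] L

theorem word_invLetter (γ : ι → G) (h : ι × Bool) : word γ [invLetter h] = (word γ [h])⁻¹ := by
  rw [word, word, ← map_inv, FreeGroup.inv_mk]
  rfl

theorem word_mem (hgen : Subgroup.closure (Set.range γ) = Γ) (L : List (ι × Bool)) :
    word γ L ∈ Γ := by
  rw [← hgen, ← FreeGroup.range_lift_eq_closure]
  exact ⟨_, rfl⟩

theorem exists_isReduced_word_eq (hgen : Subgroup.closure (Set.range γ) = Γ) {δ : G}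
    (hδ : δ ∈ Γ) : ∃ L, FreeGroup.IsReduced L ∧ word γ L = δ := by
  classical
  rw [← hgen, ← FreeGroup.range_lift_eq_closure] at hδ
  obtain ⟨x, rfl⟩ := hδ
  exact ⟨x.toWord, FreeGroup.isReduced_toWord, by rw [word, FreeGroup.mk_toWord]⟩

theorem exists_eq_append_cons {L : List (ι × Bool)} {N : ℕ} (hL : FreeGroup.IsReduced L)
    (hlen : N + 1 < L.length) :
    ∃ U l k V, L = U ++ k :: V ∧ U.length = N + 1 ∧ FreeGroup.IsReduced U ∧ l ∈ U.getLast? ∧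
      FreeGroup.IsReduced (k :: V) ∧ k ≠ invLetter l := by
  obtain ⟨U, V, rfl, hU⟩ : ∃ U V, L = U ++ V ∧ U.length = N + 1 :=
    ⟨L.take (N + 1), L.drop (N + 1), (List.take_append_drop _ _).symm, by simp; omega⟩
  obtain ⟨k, V, rfl⟩ := List.exists_cons_of_length_pos (l := V) (by simp at hlen; omega)
  obtain ⟨hU', hV, hUV⟩ := List.isChain_append.1 hL
  have hU0 : U ≠ [] := List.ne_nil_of_length_pos (by omega)
  have hl := List.getLast?_eq_getLast_of_ne_nil hU0
  exact ⟨U, _, k, V, rfl, hU, hU', hl, hV, ne_invLetter (hUV _ hl k rfl)⟩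

end Words

section PingPong

variable {ι K : Type*} [NormedField K]

/-- The balls `D h`, indexed by the letters, are in ping-pong position for the generators `γ i`: the
letter `h` maps the complement of the open ball of `h⁻¹` into the closed ball of `h`, and the balls
are separated, with ratios at most `q < 1`. -/
structure IsPingPong (γ : ι → PGL(2, K)) (D : ι × Bool → Ball K) (q : ℝ) : Prop where
  nonneg : 0 ≤ q
  lt_one : q < 1
  separated : Pairwise fun h k => (D h).Separated (D k)
  ratio_le : ∀ h k, h ≠ k → ballRatio (D h) (D k) ≤ q
  smul_mem : ∀ h, ∀ x ∉ (D (invLetter h)).openSet, word γ [h] • x ∈ (D h).closedSet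

/-- The complement of the open balls of a family. -/
def fundamentalDomain {κ : Type*} (D : κ → Ball K) : Set (OnePoint K) :=
  {x | ∀ h, x ∉ (D h).openSet}

namespace IsPingPong

variable {γ : ι → PGL(2, K)} {D : ι × Bool → Ball K} {q : ℝ} {h k l : ι × Bool}
  {L : List (ι × Bool)} {x z : OnePoint K}

theorem smul_mem_of_ne (P : IsPingPong γ D q) (hk : k ≠ invLetter h) (hx : x ∈ (D k).closedSet) :
    word γ [h] • x ∈ (D h).closedSet :=
  P.smul_mem h x ((P.separated hk).notMem_openSet hx)

theorem inv_smul_mem (P : IsPingPong γ D q) (hx : x ∉ (D h).openSet) :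
    (word γ [h])⁻¹ • x ∈ (D (invLetter h)).closedSet := by
  rw [← word_invLetter]
  exact P.smul_mem _ _ (by rwa [invLetter_invLetter])

theorem word_smul_mem (P : IsPingPong γ D q) (hL : FreeGroup.IsReduced (h :: L))
    (hx : ∀ l ∈ (h :: L).getLast?, x ∉ (D (invLetter l)).openSet) :
    word γ (h :: L) • x ∈ (D h).closedSet := by
  induction L generalizing h with
  | nil => exact P.smul_mem h x (hx h rfl)
  | cons k L ih =>
    rw [FreeGroup.isReduced_cons_cons] at hL
    rw [word_cons, mul_smul]
    exact P.smul_mem_of_ne (ne_invLetter hL.1) (ih hL.2 (by simpa using hx))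

theorem word_inv_smul_mem (P : IsPingPong γ D q) (hL : FreeGroup.IsReduced (h :: L))
    (hz : z ∉ (D h).openSet) (hl : l ∈ (h :: L).getLast?) :
    (word γ (h :: L))⁻¹ • z ∈ (D (invLetter l)).closedSet := by
  induction L generalizing h z with
  | nil =>
    obtain rfl : h = l := by simpa using hl
    exact P.inv_smul_mem hz
  | cons k L ih =>
    rw [FreeGroup.isReduced_cons_cons] at hL
    rw [word_cons, mul_inv_rev, mul_smul]
    exact ih hL.2 ((P.separated (ne_invLetter hL.1).symm).notMem_openSet (P.inv_smul_mem hz))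
      (by simpa using hl)

theorem word_singleton_ne_one (P : IsPingPong γ D q) (h : ι × Bool) : word γ [h] ≠ 1 := by
  intro h1
  have hsep := P.separated (ne_invLetter (h := h) fun _ => rfl)
  obtain ⟨o, ho, ho'⟩ := hsep.exists_notMem
  have hoh := P.smul_mem h o ho'
  have hoh' := P.inv_smul_mem ho
  rw [h1, one_smul] at hoh
  rw [h1, inv_one, one_smul] at hoh'
  exact Set.disjoint_left.1 hsep.disjoint hoh hoh'

theorem eq_singleton_of_word_smul_eq (P : IsPingPong γ D q) (hL : FreeGroup.IsReduced L)
    (hL0 : L ≠ []) (hx : x ∈ fundamentalDomain D) (hz : z ∈ fundamentalDomain D)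
    (hxz : word γ L • x = z) :
    ∃ h, L = [h] ∧ x ∈ (D (invLetter h)).closedSet ∧ z ∈ (D h).closedSet := by
  obtain ⟨h, L, rfl⟩ := List.exists_cons_of_ne_nil hL0
  have hzh : z ∈ (D h).closedSet := hxz ▸ P.word_smul_mem hL fun _ _ => hx _
  have hLx : word γ L • x ∈ (D (invLetter h)).closedSet := by
    rw [word_cons, mul_smul, ← eq_inv_smul_iff] at hxz
    exact hxz ▸ P.inv_smul_mem (hz h)
  cases L with
  | nil => exact ⟨h, rfl, by simpa using hLx, hzh⟩
  | cons k L =>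
    rw [FreeGroup.isReduced_cons_cons] at hL
    exact (Set.disjoint_left.1 (P.separated (ne_invLetter hL.1)).disjoint
      (P.word_smul_mem hL.2 fun _ _ => hx _) hLx).elim

theorem word_smul_ne (P : IsPingPong γ D q) (hL : FreeGroup.IsReduced L)
    (hx : x ∈ fundamentalDomain D) (hz : z ∈ fundamentalDomain D) (hxk : x ∈ (D k).closedSet)
    (hzl : z ∈ (D l).closedSet) (hkl : k ≠ invLetter l) (hxz : x ≠ z) : word γ L • x ≠ z := by
  intro hLxz
  by_cases hL0 : L = []
  · exact hxz (by simpa [hL0] using hLxz)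
  obtain ⟨h, -, hxh, hzh⟩ := P.eq_singleton_of_word_smul_eq hL hL0 hx hz hLxz
  have hkh : k = invLetter h := by_contra fun e =>
    Set.disjoint_left.1 (P.separated e).disjoint hxk hxh
  have hlh : l = h := by_contra fun e => Set.disjoint_left.1 (P.separated e).disjoint hzl hzh
  exact hkl (hlh ▸ hkh)

end IsPingPong

/-- The point `t` keeps away from the limit set in that every reduced word longer than `N`, with
last letter `l`, has an inverse carrying `t` into the closed ball of `l⁻¹`. The points of the
fundamental domain have level `0`. -/
def IsOrdinaryOfLevel (γ : ι → PGL(2, K)) (D : ι × Bool → Ball K) (N : ℕ) (t : OnePoint K) : Prop :=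
  ∀ U, FreeGroup.IsReduced U → N < U.length → ∀ l ∈ U.getLast?,
    (word γ U)⁻¹ • t ∈ (D (invLetter l)).closedSet

variable {γ : ι → PGL(2, K)} {D : ι × Bool → Ball K} {q : ℝ} {L : List (ι × Bool)} {N : ℕ}
  {t x z : OnePoint K}

theorem IsPingPong.isOrdinaryOfLevel_zero (P : IsPingPong γ D q) (hz : z ∈ fundamentalDomain D) :
    IsOrdinaryOfLevel γ D 0 z := by
  intro U hU hlen l hl
  obtain ⟨h, U, rfl⟩ := List.exists_cons_of_length_pos hlen
  exact P.word_inv_smul_mem hU (hz h) hl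

theorem IsOrdinaryOfLevel.mono {M : ℕ} (ht : IsOrdinaryOfLevel γ D M t) (hMN : M ≤ N) :
    IsOrdinaryOfLevel γ D N t :=
  fun U hU hlen => ht U hU (hMN.trans_lt hlen)

theorem IsOrdinaryOfLevel.word_smul_ne (ht : IsOrdinaryOfLevel γ D N t) (P : IsPingPong γ D q)
    (hx : x ∈ fundamentalDomain D) (hL : FreeGroup.IsReduced L) (hlen : N + 1 < L.length) :
    word γ L • x ≠ t := by
  obtain ⟨U, l, k, V, rfl, hU, hUr, hl, hV, hkl⟩ := exists_eq_append_cons hL hlen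
  rintro rfl
  have hVt := ht U hUr (by omega) l hl
  rw [word_append, mul_smul, inv_smul_smul] at hVt
  exact Set.disjoint_left.1 (P.separated hkl).disjoint (P.word_smul_mem hV fun _ _ => hx _) hVt

end PingPong

section Contraction

variable {ι K : Type*} [DenselyNormedField K] [IsUltrametricDist K] {γ : ι → PGL(2, K)}
  {D : ι × Bool → Ball K} {q : ℝ} {h k l : ι × Bool} {L : List (ι × Bool)}
  {s t x y z w : OnePoint K} {m N : ℕ}

namespace IsPingPong

theorem norm_crossRatio_le (P : IsPingPong γ D q) (hhk : h ≠ k) (hz : z ∈ (D h).closedSet)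
    (hw : w ∈ (D h).closedSet) (hx : x ∈ (D k).closedSet) (hy : y ∈ (D k).closedSet) :
    ‖crossRatio z w x y‖ ≤ q * (D k).chordal x y := by
  rw [(P.separated hhk).norm_crossRatio hz hw hx hy]
  refine mul_le_mul_of_nonneg_right ?_ ((D k).chordal_nonneg x y)
  exact (mul_le_of_le_one_right (ballRatio_nonneg _ _) ((D h).chordal_le_one z w)).trans
    (P.ratio_le h k hhk)

theorem chordal_smul_le (P : IsPingPong γ D q) (hk : k ≠ invLetter h) (hx : x ∈ (D k).closedSet)
    (hy : y ∈ (D k).closedSet) :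
    (D h).chordal (word γ [h] • x) (word γ [h] • y) ≤ q * (D k).chordal x y := by
  refine Ball.chordal_le_of_forall_norm_crossRatio_le (P.smul_mem_of_ne hk hx)
    (P.smul_mem_of_ne hk hy) fun z w hz hw => ?_
  rw [← crossRatio_smul (word γ [h])⁻¹, inv_smul_smul, inv_smul_smul]
  exact P.norm_crossRatio_le hk.symm (P.inv_smul_mem hz) (P.inv_smul_mem hw) hx hy

theorem chordal_word_smul_le (P : IsPingPong γ D q) (hL : FreeGroup.IsReduced (h :: L))
    (hx : ∀ l ∈ (h :: L).getLast?, x ∉ (D (invLetter l)).openSet)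
    (hy : ∀ l ∈ (h :: L).getLast?, y ∉ (D (invLetter l)).openSet) :
    (D h).chordal (word γ (h :: L) • x) (word γ (h :: L) • y) ≤ q ^ L.length := by
  induction L generalizing h with
  | nil => exact (D h).chordal_le_one _ _
  | cons k L ih =>
    rw [FreeGroup.isReduced_cons_cons] at hL
    rw [List.getLast?_cons_cons] at hx hy
    rw [word_cons, mul_smul, mul_smul, List.length_cons, pow_succ']
    exact (P.chordal_smul_le (ne_invLetter hL.1) (P.word_smul_mem hL.2 hx)
      (P.word_smul_mem hL.2 hy)).trans (mul_le_mul_of_nonneg_left (ih hL.2 hx hy) P.nonneg)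

end IsPingPong

theorem IsPingPong.norm_crossRatio_word_smul_le (P : IsPingPong γ D q)
    (hs : IsOrdinaryOfLevel γ D N s) (ht : IsOrdinaryOfLevel γ D N t)
    (hx : x ∈ fundamentalDomain D) (hy : y ∈ fundamentalDomain D) (hL : FreeGroup.IsReduced L)
    (hm : 1 ≤ m) (hlen : N + 1 + m ≤ L.length) :
    ‖crossRatio s t (word γ L • x) (word γ L • y)‖ ≤ q ^ m := by
  obtain ⟨U, l, k, V, rfl, hU, hUr, hl, hV, hkl⟩ := exists_eq_append_cons (N := N) hL (by omega)
  have hNU : N < U.length := by omega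
  rw [List.length_append, List.length_cons] at hlen
  rw [← crossRatio_smul (word γ U)⁻¹, word_append, mul_smul, mul_smul, inv_smul_smul,
    inv_smul_smul]
  calc _ ≤ q * (D k).chordal (word γ (k :: V) • x) (word γ (k :: V) • y) :=
        P.norm_crossRatio_le hkl.symm (hs U hUr hNU l hl) (ht U hUr hNU l hl)
          (P.word_smul_mem hV fun _ _ => hx _) (P.word_smul_mem hV fun _ _ => hy _)
    _ ≤ q * q ^ V.length := mul_le_mul_of_nonneg_left
        (P.chordal_word_smul_le hV (fun _ _ => hx _) fun _ _ => hy _) P.nonneg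
    _ = q ^ (V.length + 1) := (pow_succ' q _).symm
    _ ≤ q ^ m := pow_le_pow_of_le_one P.nonneg P.lt_one.le (by omega)

variable [CompleteSpace K]

theorem IsPingPong.exists_fixedPoint (P : IsPingPong γ D q) (h : ι × Bool) :
    ∃ x ∈ (D h).closedSet, word γ [h] • x = x :=
  have hne : h ≠ invLetter h := ne_invLetter fun _ => rfl
  Ball.exists_fixedPoint P.nonneg P.lt_one (fun _ => P.smul_mem_of_ne hne)
    fun _ hx _ hy => P.chordal_smul_le hne hx hy

theorem IsPingPong.exists_mem_fixedPts_chordal_le (P : IsPingPong γ D q) {Γ : Subgroup PGL(2, K)}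
    (hgen : Subgroup.closure (Set.range γ) = Γ) (hL : FreeGroup.IsReduced (h :: L))
    (hl : l ∈ (h :: L).getLast?)
    (ht : (word γ (h :: L))⁻¹ • t ∉ (D (invLetter l)).openSet) :
    ∃ y ∈ fixedPts Γ, (D h).chordal t y ≤ q ^ L.length := by
  obtain ⟨f, hf, hff⟩ := P.exists_fixedPoint l
  refine ⟨word γ (h :: L) • f, ⟨word γ (h :: L) * word γ [l] * (word γ (h :: L))⁻¹, ?_, ?_, ?_⟩, ?_⟩
  · exact mul_mem (mul_mem (word_mem hgen _) (word_mem hgen _)) (inv_mem (word_mem hgen _))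
  · exact mt conj_eq_one_iff.1 (P.word_singleton_ne_one l)
  · rw [mul_smul, mul_smul, inv_smul_smul, hff]
  · have hf' : f ∉ (D (invLetter l)).openSet :=
      (P.separated (ne_invLetter fun _ => rfl)).notMem_openSet hf
    have last_eq {l'} (hl' : l' ∈ (h :: L).getLast?) : l = l' := Option.mem_unique hl hl'
    have := P.chordal_word_smul_le hL (fun l' hl' => last_eq hl' ▸ ht)
      fun l' hl' => last_eq hl' ▸ hf'
    rwa [smul_inv_smul] at this

theorem IsPingPong.exists_isOrdinaryOfLevel_infty [Finite ι] (P : IsPingPong γ D q)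
    {Γ : Subgroup PGL(2, K)} (hgen : Subgroup.closure (Set.range γ) = Γ)
    (hinf : OnePoint.infty ∉ badPts Γ) : ∃ N, IsOrdinaryOfLevel γ D N OnePoint.infty := by
  obtain ⟨C, hC, hCfix⟩ : ∃ C : Ball K, OnePoint.infty ∈ C.openSet ∧
      ¬(C.openSet ∩ fixedPts Γ).Nonempty := by
    simpa [badPts] using hinf
  have hpow : ∀ᶠ n in Filter.atTop, ∀ h, q ^ n < (D h).radius / joinRadius (D h) C :=
    Filter.eventually_all.2 fun h =>
      (tendsto_pow_atTop_nhds_zero_of_lt_one P.nonneg P.lt_one).eventually_lt_const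
        (div_pos (D h).radius_pos (joinRadius_pos _ _))
  obtain ⟨N, hN⟩ := hpow.exists
  refine ⟨N, fun U hU hlen l hl => by_contra fun hUl => ?_⟩
  obtain ⟨h, U, rfl⟩ := List.exists_cons_of_length_pos (Nat.zero_lt_of_lt hlen)
  obtain ⟨y, hy, hty⟩ := P.exists_mem_fixedPts_chordal_le hgen hU hl
    (mt ((D _).openSet_subset_closedSet ·) hUl)
  refine hCfix ⟨y, Ball.mem_openSet_of_chordal_infty_lt hC ((hty.trans ?_).trans_lt (hN h)), hy⟩
  exact pow_le_pow_of_le_one P.nonneg P.lt_one.le (Nat.lt_succ_iff.1 hlen)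

end Contraction

section Products

variable {K β : Type*} [NormedField K] {f : β → K} {s t : Finset β} {ε : ℝ}

theorem exists_finset_forall_norm_sub_one_le (h : Filter.Tendsto f Filter.cofinite (nhds 1))
    (hε : 0 < ε) : ∃ s : Finset β, ∀ i ∉ s, ‖f i - 1‖ ≤ ε := by
  have hfin : {i | ¬ ‖f i - 1‖ ≤ ε}.Finite := (Metric.tendsto_nhds.1 h ε hε).mono fun i hi =>
    (dist_eq_norm (f i) 1 ▸ hi).le
  exact ⟨hfin.toFinset, fun i hi => by simpa using hi⟩

variable [IsUltrametricDist K]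

theorem norm_eq_one_of_norm_sub_one_lt_one {x : K} (h : ‖x - 1‖ < 1) : ‖x‖ = 1 := by
  simpa using norm_eq_of_norm_sub_lt (v := (1 : K)) (by simpa using h)

theorem norm_prod_sub_one_le (hε : 0 ≤ ε) (hε1 : ε < 1) (h : ∀ i ∈ s, ‖f i - 1‖ ≤ ε) :
    ‖∏ i ∈ s, f i - 1‖ ≤ ε := by
  classical
  induction s using Finset.induction_on with
  | empty => simpa using hε
  | insert i s hi ih =>
    have hfi := h i (Finset.mem_insert_self _ _)
    have hs := ih fun k hk => h k (Finset.mem_insert_of_mem hk)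
    calc ‖∏ k ∈ insert i s, f k - 1‖ = ‖f i * (∏ k ∈ s, f k - 1) + (f i - 1)‖ := by
          rw [Finset.prod_insert hi]; ring_nf
      _ ≤ max ‖f i * (∏ k ∈ s, f k - 1)‖ ‖f i - 1‖ := IsUltrametricDist.norm_add_le_max _ _
      _ ≤ ε := by
          rw [norm_mul, norm_eq_one_of_norm_sub_one_lt_one (hfi.trans_lt hε1), one_mul]
          exact max_le hs hfi

theorem norm_prod_sub_prod_le (hε : 0 ≤ ε) (hε1 : ε < 1) (h : ∀ i ∉ s, ‖f i - 1‖ ≤ ε)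
    (hst : s ⊆ t) : ‖∏ i ∈ t, f i - ∏ i ∈ s, f i‖ ≤ ε * ‖∏ i ∈ s, f i‖ := by
  classical
  rw [← Finset.prod_sdiff hst, ← sub_one_mul, norm_mul]
  exact mul_le_mul_of_nonneg_right
    (norm_prod_sub_one_le hε hε1 fun i hi => h i (Finset.mem_sdiff.1 hi).2) (norm_nonneg _)

theorem norm_tprod_sub_prod_le (hf : Multipliable f) (hε : 0 ≤ ε) (hε1 : ε < 1)
    (h : ∀ i ∉ s, ‖f i - 1‖ ≤ ε) : ‖∏' i, f i - ∏ i ∈ s, f i‖ ≤ ε * ‖∏ i ∈ s, f i‖ := by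
  have hlim : Filter.Tendsto (fun t : Finset β => ∏ i ∈ t, f i) Filter.atTop (nhds (∏' i, f i)) :=
    by simpa [HasProd] using hf.hasProd
  exact le_of_tendsto (hlim.sub_const _).norm
    ((Filter.eventually_ge_atTop s).mono fun t hst => norm_prod_sub_prod_le hε hε1 h hst)

theorem norm_tprod_eq_norm_prod (hf : Multipliable f) (hε : 0 ≤ ε) (hε1 : ε < 1)
    (hs : ∏ i ∈ s, f i ≠ 0) (h : ∀ i ∉ s, ‖f i - 1‖ ≤ ε) : ‖∏' i, f i‖ = ‖∏ i ∈ s, f i‖ :=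
  norm_eq_of_norm_sub_lt ((norm_tprod_sub_prod_le hf hε hε1 h).trans_lt
    (mul_lt_of_lt_one_left (norm_pos_iff.2 hs) hε1))

theorem tprod_ne_zero (hf : Multipliable f) (h : Filter.Tendsto f Filter.cofinite (nhds 1))
    (h0 : ∀ i, f i ≠ 0) : ∏' i, f i ≠ 0 := by
  obtain ⟨s, hs⟩ := exists_finset_forall_norm_sub_one_le h (half_pos one_pos)
  have hs0 : ∏ i ∈ s, f i ≠ 0 := Finset.prod_ne_zero_iff.2 fun i _ => h0 i
  rwa [← norm_ne_zero_iff, norm_tprod_eq_norm_prod hf (half_pos one_pos).le (half_lt_self one_pos)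
    hs0 hs, norm_ne_zero_iff]

theorem norm_prod_div_tprod_sub_one_le (hf : Multipliable f) (h0 : ∀ i, f i ≠ 0) (hε : 0 ≤ ε)
    (hε1 : ε < 1) (h : ∀ i ∉ s, ‖f i - 1‖ ≤ ε) : ‖(∏ i ∈ s, f i) / ∏' i, f i - 1‖ ≤ ε := by
  have hs : ∏ i ∈ s, f i ≠ 0 := Finset.prod_ne_zero_iff.2 fun i _ => h0 i
  have hnorm := norm_tprod_eq_norm_prod hf hε hε1 hs h
  have htprod : ∏' i, f i ≠ 0 := norm_ne_zero_iff.1 (hnorm ▸ norm_ne_zero_iff.2 hs)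
  rw [div_sub_one htprod, norm_div, div_le_iff₀ (norm_pos_iff.2 htprod), norm_sub_rev, hnorm]
  exact norm_tprod_sub_prod_le hf hε hε1 h

theorem multipliable_of_tendsto_cofinite_one [CompleteSpace K]
    (h : Filter.Tendsto f Filter.cofinite (nhds 1)) : Multipliable f := by
  classical
  obtain ⟨s, hs⟩ := exists_finset_forall_norm_sub_one_le h (half_pos one_pos)
  have hcauchy : CauchySeq fun t : Finset β => ∏ i ∈ t, f i := by
    refine Metric.cauchySeq_iff'.2 fun ε hε => ?_
    set c := ‖∏ i ∈ s, f i‖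
    have hc : 0 ≤ c := norm_nonneg _
    have hη : 0 < min (1 / 2) (ε / (c + 1)) := by positivity
    obtain ⟨s', hs'⟩ := exists_finset_forall_norm_sub_one_le h hη
    refine ⟨s ∪ s', fun t ht => ?_⟩
    have hprod : ‖∏ i ∈ s ∪ s', f i‖ ≤ c := by
      have := norm_prod_sub_prod_le (half_pos one_pos).le (half_lt_self one_pos) hs
        (Finset.subset_union_left (s₂ := s'))
      calc ‖∏ i ∈ s ∪ s', f i‖ = ‖(∏ i ∈ s ∪ s', f i - ∏ i ∈ s, f i) + ∏ i ∈ s, f i‖ := by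
            rw [sub_add_cancel]
        _ ≤ c := (IsUltrametricDist.norm_add_le_max _ _).trans
            (max_le (this.trans (mul_le_of_le_one_left hc (half_le_self zero_le_one))) le_rfl)
    calc dist (∏ i ∈ t, f i) (∏ i ∈ s ∪ s', f i)
        ≤ min (1 / 2) (ε / (c + 1)) * ‖∏ i ∈ s ∪ s', f i‖ := by
          rw [dist_eq_norm]
          exact norm_prod_sub_prod_le hη.le ((min_le_left _ _).trans_lt (half_lt_self one_pos))
            (fun i hi => hs' i fun hi' => hi (Finset.mem_union_right _ hi')) ht
      _ ≤ ε / (c + 1) * c := by gcongr; exact min_le_right _ _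
      _ < ε := by rw [div_mul_eq_mul_div, div_lt_iff₀ (by positivity)]; nlinarith
  obtain ⟨a, ha⟩ := cauchySeq_tendsto_of_complete hcauchy
  exact ⟨a, by simpa [HasProd] using ha⟩

end Products

section WordBall

variable {G : Type*} [Group G] {g : ℕ} {γ : Fin g → G} {Γ : Subgroup G}

open Classical in
/-- The ball `wordBall γ m` as a finite set of elements of `Γ`. -/
def wordBallFinset (γ : Fin g → G) (Γ : Subgroup G) (m : ℕ) : Finset Γ :=
  (wordBall_finite γ m).toFinset.subtype (· ∈ Γ)

theorem prod_wordBallFinset {M : Type*} [CommMonoid M]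
    (hgen : Subgroup.closure (Set.range γ) = Γ) (m : ℕ) (f : G → M) :
    ∏ δ ∈ wordBallFinset γ Γ m, f δ = ∏ δ ∈ (wordBall_finite γ m).toFinset, f δ := by
  classical
  refine Finset.prod_subtype_of_mem f fun δ hδ => ?_
  obtain ⟨L, -, -, rfl⟩ := (wordBall_finite γ m).mem_toFinset.1 hδ
  exact word_mem hgen L

theorem exists_word_of_notMem_wordBallFinset (hgen : Subgroup.closure (Set.range γ) = Γ) {m : ℕ}
    {δ : Γ} (hδ : δ ∉ wordBallFinset γ Γ m) :
    ∃ L, FreeGroup.IsReduced L ∧ m < L.length ∧ word γ L = δ := by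
  classical
  obtain ⟨L, hL, hLδ⟩ := exists_isReduced_word_eq hgen δ.2
  refine ⟨L, hL, ?_, hLδ⟩
  by_contra! hlen
  exact hδ (Finset.mem_subtype.2 ((wordBall_finite γ m).mem_toFinset.2 ⟨L, hlen, hL, hLδ⟩))

end WordBall

section OrbitProducts

variable {K : Type*} [Field K] {g : ℕ} {γ : Fin g → PGL(2, K)} {Γ : Subgroup PGL(2, K)}
  {a b z w : OnePoint K}

theorem ne_smul_of_notMem_orbit (hza : z ∉ MulAction.orbit Γ a) (δ : Γ) :
    z ≠ (δ : PGL(2, K)) • a :=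
  fun h => hza ⟨δ, h.symm⟩

theorem factor_smul_ne_zero (hza : z ∉ MulAction.orbit Γ a) (hzb : z ∉ MulAction.orbit Γ b)
    (δ : Γ) : factor ((δ : PGL(2, K)) • a) ((δ : PGL(2, K)) • b) z ≠ 0 :=
  factor_ne_zero (ne_smul_of_notMem_orbit hza δ) (ne_smul_of_notMem_orbit hzb δ)

theorem factor_smul_div_factor_smul_sub_one (hzb : z ∉ MulAction.orbit Γ b)
    (hwa : w ∉ MulAction.orbit Γ a) (hwb : w ∉ MulAction.orbit Γ b) (δ : Γ) :
    factor ((δ : PGL(2, K)) • a) ((δ : PGL(2, K)) • b) z /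
      factor ((δ : PGL(2, K)) • a) ((δ : PGL(2, K)) • b) w - 1 =
    crossRatio z w ((δ : PGL(2, K)) • a) ((δ : PGL(2, K)) • b) :=
  factor_div_factor_sub_one (ne_smul_of_notMem_orbit hzb δ) (ne_smul_of_notMem_orbit hwa δ)
    (ne_smul_of_notMem_orbit hwb δ)

theorem thetaTrunc_div_thetaTrunc (hgen : Subgroup.closure (Set.range γ) = Γ) (m : ℕ)
    (a b z w : OnePoint K) : thetaTrunc γ m a b z / thetaTrunc γ m a b w =
      ∏ δ ∈ wordBallFinset γ Γ m, factor ((δ : PGL(2, K)) • a) ((δ : PGL(2, K)) • b) z /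
        factor ((δ : PGL(2, K)) • a) ((δ : PGL(2, K)) • b) w := by
  rw [thetaTrunc, thetaTrunc, ← Finset.prod_div_distrib, ← prod_wordBallFinset hgen m]

end OrbitProducts

section Theta

variable {K : Type*} [DenselyNormedField K] {g : ℕ} {γ : Fin g → PGL(2, K)}
  {D : Fin g × Bool → Ball K} {q : ℝ} {Γ : Subgroup PGL(2, K)} {s t a b x z w : OnePoint K}
  {m N : ℕ}

theorem IsOrdinaryOfLevel.eventually_smul_ne (ht : IsOrdinaryOfLevel γ D N t)
    (P : IsPingPong γ D q) (hgen : Subgroup.closure (Set.range γ) = Γ)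
    (hx : x ∈ fundamentalDomain D) :
    ∀ᶠ δ : Γ in Filter.cofinite, (δ : PGL(2, K)) • x ≠ t := by
  filter_upwards [(wordBallFinset γ Γ (N + 1)).finite_toSet.compl_mem_cofinite] with δ hδ
  obtain ⟨L, hL, hlen, hLδ⟩ := exists_word_of_notMem_wordBallFinset hgen hδ
  exact hLδ ▸ ht.word_smul_ne P hx hL hlen

variable [IsUltrametricDist K]

namespace IsPingPong

theorem norm_crossRatio_smul_le (P : IsPingPong γ D q)
    (hgen : Subgroup.closure (Set.range γ) = Γ) (hs : IsOrdinaryOfLevel γ D N s)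
    (ht : IsOrdinaryOfLevel γ D N t) (ha : a ∈ fundamentalDomain D) (hb : b ∈ fundamentalDomain D)
    (hm : 1 ≤ m) {δ : Γ} (hδ : δ ∉ wordBallFinset γ Γ (N + m)) :
    ‖crossRatio s t ((δ : PGL(2, K)) • a) ((δ : PGL(2, K)) • b)‖ ≤ q ^ m := by
  obtain ⟨L, hL, hlen, hLδ⟩ := exists_word_of_notMem_wordBallFinset hgen hδ
  exact hLδ ▸ P.norm_crossRatio_word_smul_le hs ht ha hb hL hm (by omega)

theorem tendsto_crossRatio_smul (P : IsPingPong γ D q)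
    (hgen : Subgroup.closure (Set.range γ) = Γ) (hs : IsOrdinaryOfLevel γ D N s)
    (ht : IsOrdinaryOfLevel γ D N t) (ha : a ∈ fundamentalDomain D)
    (hb : b ∈ fundamentalDomain D) :
    Filter.Tendsto (fun δ : Γ => crossRatio s t ((δ : PGL(2, K)) • a) ((δ : PGL(2, K)) • b))
      Filter.cofinite (nhds 0) := by
  refine NormedAddGroup.tendsto_nhds_zero.2 fun ε hε => ?_
  obtain ⟨n, hn⟩ := exists_pow_lt_of_lt_one hε P.lt_one
  filter_upwards [(wordBallFinset γ Γ (N + (n + 1))).finite_toSet.compl_mem_cofinite] with δ hδ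
  calc _ ≤ q ^ (n + 1) := P.norm_crossRatio_smul_le hgen hs ht ha hb (Nat.le_add_left 1 n) hδ
    _ ≤ q ^ n := pow_le_pow_of_le_one P.nonneg P.lt_one.le n.le_succ
    _ < ε := hn

theorem tendsto_factor_smul_div_factor_smul (P : IsPingPong γ D q)
    (hgen : Subgroup.closure (Set.range γ) = Γ) (ha : a ∈ fundamentalDomain D)
    (hb : b ∈ fundamentalDomain D) (hz : z ∈ fundamentalDomain D) (hw : w ∈ fundamentalDomain D)
    (hzb : z ∉ MulAction.orbit Γ b) (hwa : w ∉ MulAction.orbit Γ a)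
    (hwb : w ∉ MulAction.orbit Γ b) :
    Filter.Tendsto (fun δ : Γ => factor ((δ : PGL(2, K)) • a) ((δ : PGL(2, K)) • b) z /
      factor ((δ : PGL(2, K)) • a) ((δ : PGL(2, K)) • b) w) Filter.cofinite (nhds 1) := by
  rw [← tendsto_sub_nhds_zero_iff]
  refine (P.tendsto_crossRatio_smul hgen (P.isOrdinaryOfLevel_zero hz)
    (P.isOrdinaryOfLevel_zero hw) ha hb).congr fun δ => ?_
  exact (factor_smul_div_factor_smul_sub_one hzb hwa hwb δ).symm

theorem tendsto_factor_smul (P : IsPingPong γ D q) (hgen : Subgroup.closure (Set.range γ) = Γ)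
    (hinf : IsOrdinaryOfLevel γ D N OnePoint.infty) (ha : a ∈ fundamentalDomain D)
    (hb : b ∈ fundamentalDomain D) (hz : z ∈ fundamentalDomain D)
    (hzb : z ∉ MulAction.orbit Γ b) :
    Filter.Tendsto (fun δ : Γ => factor ((δ : PGL(2, K)) • a) ((δ : PGL(2, K)) • b) z)
      Filter.cofinite (nhds 1) := by
  rw [← tendsto_sub_nhds_zero_iff]
  refine (P.tendsto_crossRatio_smul hgen ((P.isOrdinaryOfLevel_zero hz).mono N.zero_le) hinf
    ha hb).congr' ?_
  filter_upwards [hinf.eventually_smul_ne P hgen ha, hinf.eventually_smul_ne P hgen hb]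
    with δ hδa hδb
  rw [← factor_div_factor_sub_one (ne_smul_of_notMem_orbit hzb δ) hδa.symm hδb.symm,
    factor_infty hδa hδb, div_one]

variable [CompleteSpace K]

theorem multipliable_thetaQuot (P : IsPingPong γ D q)
    (hgen : Subgroup.closure (Set.range γ) = Γ) (ha : a ∈ fundamentalDomain D)
    (hb : b ∈ fundamentalDomain D) (hz : z ∈ fundamentalDomain D) (hw : w ∈ fundamentalDomain D)
    (hzb : z ∉ MulAction.orbit Γ b) (hwa : w ∉ MulAction.orbit Γ a)
    (hwb : w ∉ MulAction.orbit Γ b) :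
    Multipliable fun δ : Γ => factor ((δ : PGL(2, K)) • a) ((δ : PGL(2, K)) • b) z /
      factor ((δ : PGL(2, K)) • a) ((δ : PGL(2, K)) • b) w :=
  multipliable_of_tendsto_cofinite_one
    (P.tendsto_factor_smul_div_factor_smul hgen ha hb hz hw hzb hwa hwb)

theorem thetaQuot_ne_zero (P : IsPingPong γ D q)
    (hgen : Subgroup.closure (Set.range γ) = Γ) (ha : a ∈ fundamentalDomain D)
    (hb : b ∈ fundamentalDomain D) (hz : z ∈ fundamentalDomain D) (hw : w ∈ fundamentalDomain D)
    (hza : z ∉ MulAction.orbit Γ a) (hzb : z ∉ MulAction.orbit Γ b)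
    (hwa : w ∉ MulAction.orbit Γ a) (hwb : w ∉ MulAction.orbit Γ b) : thetaQuot Γ a b z w ≠ 0 :=
  tprod_ne_zero (P.multipliable_thetaQuot hgen ha hb hz hw hzb hwa hwb)
    (P.tendsto_factor_smul_div_factor_smul hgen ha hb hz hw hzb hwa hwb)
    fun δ => div_ne_zero (factor_smul_ne_zero hza hzb δ) (factor_smul_ne_zero hwa hwb δ)

theorem norm_thetaTrunc_div_thetaQuot_sub_one_le (P : IsPingPong γ D q)
    (hgen : Subgroup.closure (Set.range γ) = Γ) (ha : a ∈ fundamentalDomain D)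
    (hb : b ∈ fundamentalDomain D) (hz : z ∈ fundamentalDomain D) (hw : w ∈ fundamentalDomain D)
    (hza : z ∉ MulAction.orbit Γ a) (hzb : z ∉ MulAction.orbit Γ b)
    (hwa : w ∉ MulAction.orbit Γ a) (hwb : w ∉ MulAction.orbit Γ b) (hm : 1 ≤ m) :
    ‖thetaTrunc γ m a b z / thetaTrunc γ m a b w / thetaQuot Γ a b z w - 1‖ ≤ q ^ m := by
  rw [thetaTrunc_div_thetaTrunc hgen, thetaQuot]
  refine norm_prod_div_tprod_sub_one_le (P.multipliable_thetaQuot hgen ha hb hz hw hzb hwa hwb)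
    (fun δ => div_ne_zero (factor_smul_ne_zero hza hzb δ) (factor_smul_ne_zero hwa hwb δ))
    (pow_nonneg P.nonneg m) (pow_lt_one₀ P.nonneg P.lt_one (by omega)) fun δ hδ => ?_
  rw [factor_smul_div_factor_smul_sub_one hzb hwa hwb]
  exact P.norm_crossRatio_smul_le hgen (P.isOrdinaryOfLevel_zero hz) (P.isOrdinaryOfLevel_zero hw)
    ha hb hm (by rwa [Nat.zero_add])

theorem multipliable_theta (P : IsPingPong γ D q) (hgen : Subgroup.closure (Set.range γ) = Γ)
    (hinf : OnePoint.infty ∉ badPts Γ) (ha : a ∈ fundamentalDomain D)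
    (hb : b ∈ fundamentalDomain D) (hz : z ∈ fundamentalDomain D)
    (hzb : z ∉ MulAction.orbit Γ b) :
    Multipliable fun δ : Γ => factor ((δ : PGL(2, K)) • a) ((δ : PGL(2, K)) • b) z := by
  obtain ⟨N, hN⟩ := P.exists_isOrdinaryOfLevel_infty hgen hinf
  exact multipliable_of_tendsto_cofinite_one (P.tendsto_factor_smul hgen hN ha hb hz hzb)

theorem theta_ne_zero (P : IsPingPong γ D q) (hgen : Subgroup.closure (Set.range γ) = Γ)
    (hinf : OnePoint.infty ∉ badPts Γ) (ha : a ∈ fundamentalDomain D)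
    (hb : b ∈ fundamentalDomain D) (hz : z ∈ fundamentalDomain D)
    (hza : z ∉ MulAction.orbit Γ a) (hzb : z ∉ MulAction.orbit Γ b) : theta Γ a b z ≠ 0 := by
  obtain ⟨N, hN⟩ := P.exists_isOrdinaryOfLevel_infty hgen hinf
  exact tprod_ne_zero (P.multipliable_theta hgen hinf ha hb hz hzb)
    (P.tendsto_factor_smul hgen hN ha hb hz hzb) (factor_smul_ne_zero hza hzb)

theorem theta_div_theta (P : IsPingPong γ D q) (hgen : Subgroup.closure (Set.range γ) = Γ)
    (hinf : OnePoint.infty ∉ badPts Γ) (ha : a ∈ fundamentalDomain D)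
    (hb : b ∈ fundamentalDomain D) (hz : z ∈ fundamentalDomain D) (hw : w ∈ fundamentalDomain D)
    (hzb : z ∉ MulAction.orbit Γ b) (hwa : w ∉ MulAction.orbit Γ a)
    (hwb : w ∉ MulAction.orbit Γ b) :
    theta Γ a b z / theta Γ a b w = thetaQuot Γ a b z w :=
  ((P.multipliable_theta hgen hinf ha hb hz hzb).hasProd.div₀
    (P.multipliable_theta hgen hinf ha hb hw hwb).hasProd
    (P.theta_ne_zero hgen hinf ha hb hw hwa hwb)).tprod_eq.symm

end IsPingPong

end Theta

section GoodPosition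

variable {K : Type*} [NormedField K] {g : ℕ}

/-- The index of the ball of a letter, where `(i, true)` stands for `γ i` with the ball `B i` and
`(i, false)` for `(γ i)⁻¹` with the ball `B' i`. -/
def letterIndex (h : Fin g × Bool) : Fin g ⊕ Fin g :=
  cond h.2 (Sum.inl h.1) (Sum.inr h.1)

theorem letterIndex_injective : Function.Injective (letterIndex (g := g)) := by
  rintro ⟨i, _ | _⟩ ⟨j, _ | _⟩ h <;> simp_all [letterIndex]

theorem letterIndex_surjective : Function.Surjective (letterIndex (g := g)) :=
  Sum.rec (fun i => ⟨(i, true), rfl⟩) fun i => ⟨(i, false), rfl⟩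

/-- The balls of a good fundamental domain as a family indexed by letters: the ball of a letter is
the one into which it maps the outside of the ball of the inverse letter. -/
def letterBall (B B' : Fin g → Ball K) (h : Fin g × Bool) : Ball K :=
  allBalls B B' (letterIndex h)

theorem minDist_le_pointDist (p : ℝ) (B B' : Fin g → Ball K) {h k : Fin g × Bool} (hhk : h ≠ k) :
    minDist p B B' ≤ pointDist p (letterBall B B' h) (letterBall B B' k) :=
  ciInf_le (Set.finite_range _).bddBelow (⟨(_, _), letterIndex_injective.ne hhk⟩ :
    {q : (Fin g ⊕ Fin g) × (Fin g ⊕ Fin g) // q.1 ≠ q.2})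

theorem exists_pointDist_eq_minDist (p : ℝ) (B B' : Fin g → Ball K) (i : Fin g) :
    ∃ h k, h ≠ k ∧ pointDist p (letterBall B B' h) (letterBall B B' k) = minDist p B B' := by
  have : Nonempty {q : (Fin g ⊕ Fin g) × (Fin g ⊕ Fin g) // q.1 ≠ q.2} :=
    ⟨⟨(Sum.inl i, Sum.inr i), Sum.inl_ne_inr⟩⟩
  obtain ⟨⟨⟨u, v⟩, huv⟩, hmin⟩ := exists_eq_ciInf_of_finite
    (f := fun q : {q : (Fin g ⊕ Fin g) × (Fin g ⊕ Fin g) // q.1 ≠ q.2} =>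
      pointDist p (allBalls B B' q.1.1) (allBalls B B' q.1.2))
  obtain ⟨h, rfl⟩ := letterIndex_surjective u
  obtain ⟨k, rfl⟩ := letterIndex_surjective v
  exact ⟨h, k, ne_of_apply_ne letterIndex huv, hmin⟩

namespace IsGoodFundamentalDomain

variable {γ : Fin g → PGL(2, K)} {B B' : Fin g → Ball K} {i : Fin g} {x : OnePoint K}

theorem letterBall_disjoint (hF : IsGoodFundamentalDomain γ B B') : Pairwise fun h k =>
    Disjoint (letterBall B B' h).closedSet (letterBall B B' k).closedSet :=
  fun _ _ hne => hF.disjoint (letterIndex_injective.ne hne)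

theorem mem_fundamentalDomain (hF : IsGoodFundamentalDomain γ B B') {k : Fin g × Bool}
    (hx : x ∈ (letterBall B B' k).closedSet \ (letterBall B B' k).openSet) :
    x ∈ fundamentalDomain (letterBall B B') := fun h hxh => by
  obtain rfl | hkh := eq_or_ne k h
  · exact hx.2 hxh
  · exact Set.disjoint_left.1 (hF.letterBall_disjoint hkh) hx.1
      (Ball.openSet_subset_closedSet _ hxh)

theorem smul_mem_boundary (hF : IsGoodFundamentalDomain γ B B')
    (hx : x ∈ (B' i).closedSet \ (B' i).openSet) : γ i • x ∈ (B i).closedSet \ (B i).openSet := by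
  refine ⟨hF.image i ▸ ⟨x, hx.2, rfl⟩, ?_⟩
  obtain ⟨y, hy, rfl⟩ := (hF.image_inv i).symm ▸ hx.1
  simpa using hy

theorem word_smul_mem (hF : IsGoodFundamentalDomain γ B B') (h : Fin g × Bool)
    (hx : x ∉ (letterBall B B' (invLetter h)).openSet) :
    word γ [h] • x ∈ (letterBall B B' h).closedSet := by
  obtain ⟨i, _ | _⟩ := h
  · rw [show word γ [(i, false)] = (γ i)⁻¹ by simp [word]]
    exact hF.image_inv i ▸ ⟨x, hx, rfl⟩
  · rw [show word γ [(i, true)] = γ i by simp [word]]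
    exact hF.image i ▸ ⟨x, hx, rfl⟩

theorem separated (hF : IsGoodFundamentalDomain γ B B')
    (hx : x ∈ fundamentalDomain (letterBall B B')) {h k : Fin g × Bool} (hhk : h ≠ k) :
    (letterBall B B' h).Separated (letterBall B B' k) :=
  ⟨hF.letterBall_disjoint hhk, x, hx h, hx k⟩

theorem isPingPong [IsUltrametricDist K] (hF : IsGoodFundamentalDomain γ B B') {p : ℝ}
    (hp : 1 < p) (i : Fin g) (hx : x ∈ fundamentalDomain (letterBall B B')) :
    IsPingPong γ (letterBall B B') (p ^ (-minDist p B B')) where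
  nonneg := Real.rpow_nonneg (by linarith) _
  lt_one := by
    obtain ⟨h, k, hhk, hmin⟩ := exists_pointDist_eq_minDist p B B' i
    rw [← hmin, rpow_neg_pointDist _ _ hp]
    exact (hF.separated hx hhk).ballRatio_lt_one
  separated h k := hF.separated hx
  ratio_le h k hhk := by
    rw [← rpow_neg_pointDist _ _ hp]
    exact Real.rpow_le_rpow_of_exponent_le hp.le (neg_le_neg (minDist_le_pointDist p B B' hhk))
  smul_mem h x := hF.word_smul_mem h

end IsGoodFundamentalDomain

end GoodPosition

section Orbits

variable {K : Type*} [NormedField K] {ι : Type*} {γ : ι → PGL(2, K)} {Γ : Subgroup PGL(2, K)}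
  {a z : OnePoint K}

theorem IsPingPong.notMem_orbit {D : ι × Bool → Ball K} {q : ℝ} (P : IsPingPong γ D q)
    (hgen : Subgroup.closure (Set.range γ) = Γ) {k l : ι × Bool}
    (ha : a ∈ fundamentalDomain D) (hz : z ∈ fundamentalDomain D) (hak : a ∈ (D k).closedSet)
    (hzl : z ∈ (D l).closedSet) (hkl : k ≠ invLetter l) (haz : a ≠ z) :
    z ∉ MulAction.orbit Γ a := by
  rintro ⟨⟨δ, hδ⟩, hδa⟩
  obtain ⟨L, hL, rfl⟩ := exists_isReduced_word_eq hgen hδ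
  exact P.word_smul_ne hL ha hz hak hzl hkl haz hδa

theorem orbit_generator_smul (hgen : Subgroup.closure (Set.range γ) = Γ) (i : ι)
    (a : OnePoint K) : MulAction.orbit Γ (γ i • a) = MulAction.orbit Γ a :=
  MulAction.orbit_smul (⟨γ i, hgen ▸ Subgroup.subset_closure ⟨i, rfl⟩⟩ : Γ) a

theorem generator_smul_mem_orbit_iff (hgen : Subgroup.closure (Set.range γ) = Γ) (i : ι) :
    γ i • z ∈ MulAction.orbit Γ a ↔ z ∈ MulAction.orbit Γ a := by
  rw [← MulAction.orbit_eq_iff, orbit_generator_smul hgen, MulAction.orbit_eq_iff]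

end Orbits

end MumfordCurve

end

theorem theorem3p5_general {K : Type*} [DenselyNormedField K] [IsUltrametricDist K]
    [CompleteSpace K] (p : ℝ) (hp : 1 < p) {g : ℕ} (γ : Fin g → PGL(2, K))
    (Γ : Subgroup PGL(2, K)) (hgen : Subgroup.closure (Set.range γ) = Γ)
    (B B' : Fin g → MumfordCurve.Ball K) (hF : MumfordCurve.IsGoodFundamentalDomain γ B B')
    (m : ℕ) (hm : 1 ≤ m) (i j : Fin g) (a z : OnePoint K)
    (ha : a ∈ (B' i).closedSet \ (B' i).openSet)
    (hz : z ∈ (B' j).closedSet \ (B' j).openSet) (haz : a ≠ z) :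
    (Multipliable (fun δ : Γ =>
        MumfordCurve.factor ((δ : PGL(2, K)) • a) ((δ : PGL(2, K)) • (γ i • a)) z /
          MumfordCurve.factor ((δ : PGL(2, K)) • a) ((δ : PGL(2, K)) • (γ i • a)) (γ j • z)) ∧
      MumfordCurve.thetaQuot Γ a (γ i • a) z (γ j • z) ≠ 0 ∧
      ‖MumfordCurve.thetaTrunc γ m a (γ i • a) z /
            MumfordCurve.thetaTrunc γ m a (γ i • a) (γ j • z) /
          MumfordCurve.thetaQuot Γ a (γ i • a) z (γ j • z) - 1‖
        ≤ p ^ (-(MumfordCurve.minDist p B B' * m))) ∧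
    (OnePoint.infty ∉ MumfordCurve.badPts Γ →
      Multipliable (fun δ : Γ =>
        MumfordCurve.factor ((δ : PGL(2, K)) • a) ((δ : PGL(2, K)) • (γ i • a)) z) ∧
      Multipliable (fun δ : Γ =>
        MumfordCurve.factor ((δ : PGL(2, K)) • a) ((δ : PGL(2, K)) • (γ i • a)) (γ j • z)) ∧
      MumfordCurve.theta Γ a (γ i • a) z ≠ 0 ∧
      MumfordCurve.theta Γ a (γ i • a) (γ j • z) ≠ 0 ∧
      ‖MumfordCurve.thetaTrunc γ m a (γ i • a) z /
            MumfordCurve.thetaTrunc γ m a (γ i • a) (γ j • z) /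
          (MumfordCurve.theta Γ a (γ i • a) z /
            MumfordCurve.theta Γ a (γ i • a) (γ j • z)) - 1‖
        ≤ p ^ (-(MumfordCurve.minDist p B B' * m))) := by
  open MumfordCurve in
  have haF : a ∈ fundamentalDomain (letterBall B B') :=
    hF.mem_fundamentalDomain (k := (i, false)) ha
  have hzF : z ∈ fundamentalDomain (letterBall B B') :=
    hF.mem_fundamentalDomain (k := (j, false)) hz
  have hbF : γ i • a ∈ fundamentalDomain (letterBall B B') :=
    hF.mem_fundamentalDomain (k := (i, true)) (hF.smul_mem_boundary ha)
  have hwF : γ j • z ∈ fundamentalDomain (letterBall B B') :=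
    hF.mem_fundamentalDomain (k := (j, true)) (hF.smul_mem_boundary hz)
  have P := hF.isPingPong hp i haF
  have hza : z ∉ MulAction.orbit Γ a := P.notMem_orbit (k := (i, false)) (l := (j, false)) hgen
    haF hzF ha.1 hz.1 (by simp [invLetter]) haz
  have hwa : γ j • z ∉ MulAction.orbit Γ a := by rwa [generator_smul_mem_orbit_iff hgen]
  have hzb : z ∉ MulAction.orbit Γ (γ i • a) := by rwa [orbit_generator_smul hgen]
  have hwb : γ j • z ∉ MulAction.orbit Γ (γ i • a) := by rwa [orbit_generator_smul hgen]
  have hest := P.norm_thetaTrunc_div_thetaQuot_sub_one_le hgen haF hbF hzF hwF hza hzb hwa hwb hm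
  rw [← neg_mul, Real.rpow_mul (zero_le_one.trans hp.le), Real.rpow_natCast]
  refine ⟨⟨P.multipliable_thetaQuot hgen haF hbF hzF hwF hzb hwa hwb,
    P.thetaQuot_ne_zero hgen haF hbF hzF hwF hza hzb hwa hwb, hest⟩, fun hinf => ?_⟩
  rw [P.theta_div_theta hgen hinf haF hbF hzF hwF hzb hwa hwb]
  exact ⟨P.multipliable_theta hgen hinf haF hbF hzF hzb,
    P.multipliable_theta hgen hinf haF hbF hwF hwb, P.theta_ne_zero hgen hinf haF hbF hzF hza hzb,
    P.theta_ne_zero hgen hinf haF hbF hwF hwa hwb, hest⟩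

theorem theorem3p5 {K : Type*} [NontriviallyNormedField K] [IsUltrametricDist K] [CompleteSpace K]
    [IsAlgClosed K] (p : ℝ) (hp : 1 < p) {g : ℕ} (γ : Fin g → PGL(2, K))
    (Γ : Subgroup PGL(2, K)) (hΓ : MumfordCurve.IsSchottky Γ)
    (hgen : Subgroup.closure (Set.range γ) = Γ)
    (hfree : Function.Injective (FreeGroup.lift γ))
    (B B' : Fin g → MumfordCurve.Ball K) (hF : MumfordCurve.IsGoodFundamentalDomain γ B B')
    (m : ℕ) (hm : 1 ≤ m) (i j : Fin g) (a z : OnePoint K)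
    (ha : a ∈ (B' i).closedSet \ (B' i).openSet)
    (hz : z ∈ (B' j).closedSet \ (B' j).openSet) (haz : a ≠ z) :
    (Multipliable (fun δ : Γ =>
        MumfordCurve.factor ((δ : PGL(2, K)) • a) ((δ : PGL(2, K)) • (γ i • a)) z /
          MumfordCurve.factor ((δ : PGL(2, K)) • a) ((δ : PGL(2, K)) • (γ i • a)) (γ j • z)) ∧
      MumfordCurve.thetaQuot Γ a (γ i • a) z (γ j • z) ≠ 0 ∧
      ‖MumfordCurve.thetaTrunc γ m a (γ i • a) z /
            MumfordCurve.thetaTrunc γ m a (γ i • a) (γ j • z) /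
          MumfordCurve.thetaQuot Γ a (γ i • a) z (γ j • z) - 1‖
        ≤ p ^ (-(MumfordCurve.minDist p B B' * m))) ∧
    (OnePoint.infty ∉ MumfordCurve.badPts Γ →
      Multipliable (fun δ : Γ =>
        MumfordCurve.factor ((δ : PGL(2, K)) • a) ((δ : PGL(2, K)) • (γ i • a)) z) ∧
      Multipliable (fun δ : Γ =>
        MumfordCurve.factor ((δ : PGL(2, K)) • a) ((δ : PGL(2, K)) • (γ i • a)) (γ j • z)) ∧
      MumfordCurve.theta Γ a (γ i • a) z ≠ 0 ∧
      MumfordCurve.theta Γ a (γ i • a) (γ j • z) ≠ 0 ∧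
      ‖MumfordCurve.thetaTrunc γ m a (γ i • a) z /
            MumfordCurve.thetaTrunc γ m a (γ i • a) (γ j • z) /
          (MumfordCurve.theta Γ a (γ i • a) z /
            MumfordCurve.theta Γ a (γ i • a) (γ j • z)) - 1‖
        ≤ p ^ (-(MumfordCurve.minDist p B B' * m))) := by
  let _ : DenselyNormedField K :=
    ⟨fun _ _ => MumfordCurve.exists_lt_norm_lt_of_isAlgClosed K⟩
  exact theorem3p5_general p hp γ Γ hgen B B' hF m hm i j a z ha hz haz
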